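/- Let $(\Omega,\mathfrak W,\mathbb P)=(\mathbb R,\mathcal B(\mathbb R),\gamma)^{\otimes\mathbb N}$ with $\gamma=\mathcal N(0,1)$, and let $G_i(\omega)=\omega_i$. For $q\in\mathbb N$ let $\mathcal W_q$ (the $q$-th Wiener chaos) be the closed linear span in $L^2(\mathbb P)$ of the products $\prod_i H_{k_i}(G_i)$ with $\sum_i k_i=q$, where $H_k$ is the $k$-th Hermite polynomial; let $\mathsf J_m$ be the orthogonal projection onto $\mathcal W_m$ and $\mathcal W_{\le d}=\bigoplus_{m\le d}\mathcal W_m$. Let $\mathsf L F=\sum_m(-m)\,\mathsf J_mF$ (whenever the series converges in $L^2$), let $\mathbb D^\infty$ be the closure of $\bigcup_d\mathcal W_{\le d}$ for the seminorms $F\mapsto\|\mathsf L^kF\|_{L^p(\mathbb P)}$, $k\in\mathbb N$, $p\in(1,\infty)$, and let $\Gamma(F,X)=\tfrac12\big(\mathsf L(FX)-F\,\mathsf LX-X\,\mathsf LF\big)$ for $F,X\in\mathbb D^\infty$. Proposition. Let $q\in\mathbb N$ and let $(X_n)$ be a sequence in $\mathcal W_q$ that is asymptotically normal, i.e. $X_n$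 converges in law to $\mathcal N(0,\sigma^2)$ for some $\sigma^2\ge 0$ (for instance to $\mathcal N(0,1)$). Let $(Y_n)$ be a sequence in $\mathbb D^\infty$ such that $\Gamma(X_n,Y_n)\to0$ in $L^2(\mathbb P)$. Then $(Y_n)$ is asymptotically independent of $(X_n)$, in the following sense: 1. for every bounded continuous $\varphi:\mathbb R\to\mathbb R$ and every bounded uniformly continuous $\psi:\mathbb R\to\mathbb R$, $$\mathbb E[\varphi(X_n)\psi(Y_n)]-\mathbb E[\varphi(X_n)]\,\mathbb E[\psi(Y_n)]\xrightarrow[n\to\infty]{}0;$$ 2. if moreover the laws of the $Y_n$ form a tight family (in particular if $(Y_n)$ is bounded in $L^2(\mathbb P)$), the same convergence holds for all bounded continuous $\varphi,\psi:\mathbb R\to\mathbb R$. -/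

import Mathlib

open MeasureTheory ProbabilityTheory Filter Topology
open scoped ENNReal NNReal BoundedContinuousFunction

namespace WienerSpace

/-- The Wiener space: `ℝ^ℕ` with the infinite product of standard Gaussian laws; the coordinates
`ω ↦ ω i` are independent standard Gaussian variables. -/
noncomputable def wiener : Measure (ℕ → ℝ) :=
  Measure.infinitePi (fun _ : ℕ => gaussianReal 0 1)

instance : IsProbabilityMeasure wiener := by
  unfold wiener; infer_instance

/-- Square-integrable random variables on the Wiener space. -/
abbrev L2 : Type := Lp ℝ 2 wiener

/-- The product `∏ i, H_{k i}(G i)`, where `H_n` is the `n`-th (probabilists') Hermite polynomial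
and all but finitely many `k i` are zero (recall `H_0 = 1`). -/
noncomputable def hermiteProd (k : ℕ →₀ ℕ) (ω : ℕ → ℝ) : ℝ :=
  k.prod fun i n => Polynomial.aeval (ω i) (Polynomial.hermite n)

/-- The Wiener chaos of degree `q`: the closed linear span in `L²` of the products
`∏ i, H_{k i}(G i)` with `∑ i, k i = q`. -/
noncomputable def chaos (q : ℕ) : Submodule ℝ L2 :=
  (Submodule.span ℝ {F : L2 | ∃ k : ℕ →₀ ℕ, k.degree = q ∧ F =ᵐ[wiener] hermiteProd k}).topologicalClosure

instance (q : ℕ) : CompleteSpace (chaos q) :=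
  (Submodule.isClosed_topologicalClosure _).completeSpace_coe

/-- The sum of the chaoses of degree at most `d`. -/
noncomputable def chaosLE (d : ℕ) : Submodule ℝ L2 :=
  ⨆ m ∈ Finset.range (d + 1), chaos m

/-- The orthogonal projection `J_m` onto the chaos of degree `m`. -/
noncomputable def proj (m : ℕ) : L2 →L[ℝ] L2 := (chaos m).starProjection

/-- The Ornstein–Uhlenbeck generator `L F = ∑ m, (-m) • J_m F`. On `chaosLE d` the sum is finite;
in general it is meaningful for those `F` for which the orthogonal series converges in `L²`. -/
noncomputable def ou (F : L2) : L2 := ∑' m : ℕ, (-(m : ℝ)) • proj m F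

/-- The space `𝔻^∞`: closure of the union of the spaces `chaosLE d` for the (countably generated)
family of seminorms `F ↦ ‖L^k F‖_{L^p}`, `k ∈ ℕ`, `1 < p < ∞`. Since `L` is a closed operator on
`L²`, convergence of both `L^k P_m` and `L^(k+1) P_m` in `L²` forces the series defining
`L^(k+1) F` to converge. -/
def DInf : Set L2 :=
  {F | ∃ P : ℕ → L2, (∀ m, ∃ d, P m ∈ chaosLE d) ∧
    ∀ (k : ℕ) (p : ℝ≥0∞), 1 < p → p < ∞ →
      Tendsto (fun m => eLpNorm (fun ω => (ou^[k] (P m)) ω - (ou^[k] F) ω) p wiener) atTop (𝓝 0)}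

open Classical in
/-- The product of two random variables, as an element of `L²` whenever it is square integrable
(which is the case for elements of `𝔻^∞`, as these have moments of all orders). -/
noncomputable def mulL2 (F X : L2) : L2 :=
  if h : MemLp (fun ω => F ω * X ω) 2 wiener then h.toLp else 0

/-- The carré du champ `Γ(F, X) = (L(F X) - F L X - X L F) / 2`. -/
noncomputable def Gam (F X : L2) (ω : ℕ → ℝ) : ℝ :=
  (1 / 2) * ((ou (mulL2 F X)) ω - F ω * (ou X) ω - X ω * (ou F) ω)

/-- The sequences `(Y n)` in `𝔻^∞` with `Γ(X n, Y n) → 0` in `L²`. -/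
def indepAlgebra (X : ℕ → L2) : Set (ℕ → L2) :=
  {Y | (∀ n, Y n ∈ DInf) ∧ Tendsto (fun n => eLpNorm (Gam (X n) (Y n)) 2 wiener) atTop (𝓝 0)}

end WienerSpace

/-!
Polynomials in the coordinates carry the number operator `N = ∑ i, (x_i ∂_i - ∂_i²)` and the carré
du champ `Γ(P, Q) = ∑ i, ∂_i P ∂_i Q`. The Hermite polynomials of degree `m` are eigenvectors of `N`
with eigenvalue `m` and span all polynomials, and Gaussian integration by parts gives
`E[h N P] = E[Γ(P, h)]` (`integral_numOp_smul`). Everything else is derived from these facts.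

The asymptotic independence is a form of Stein's method. For `P` in the chaos of degree `q ≥ 1` and
`ψ` of class `C¹`, integration by parts gives
`q E[P exp(itP) ψ(R)] = it E[exp(itP) ψ(R) Γ(P, P)] + E[exp(itP) ψ'(R) Γ(P, R)]`.
If `Γ(P, P)` is close to `q v` and `Γ(P, R)` is close to zero, then `g(t) = E[exp(itP) ψ(R)]` almost
solves `g' = - t v g`, so `g(t)` is close to `exp(-v t² / 2) E[ψ(R)]` (`norm_integral_expW_sub_le`).
Once this is known for all bounded uniformly continuous `ψ`, Lévy's continuity theorem, applied to
the laws of `X n` under the measures with density proportional to `ψ(Y n) + c`, gives the claim for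
all bounded continuous `φ` (`tendsto_cov_of_uniformContinuous`). Under tightness a bounded continuous
`ψ` may be replaced by its composition with a projection onto a large interval.

That `Γ(P n, P n) → q v` in `L²` is the fourth moment theorem (`tendsto_gamma_self`). It combines the
spectral inequality `E[Γ(P, P)²] ≤ (q² / 3) E[P⁴]`, which holds because `P²` only has components of
degree at most `2q`, with the convergence of the second and fourth moments. The latter rests on a
hypercontractive estimate `E[P⁴] ≤ C_d E[P²]²` for polynomials of degree at most `d`
(`exists_Ex_pow_four_le`), proved by induction on `d` from the Poincaré inequality for `P²`.

To pass from polynomials to `X n` in a chaos and `Y n` in `𝔻^∞`, one has to know that the carré du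
champ is continuous along polynomial approximations (`tendsto_gamma`). The bound is
`E[Γ(P, R)²] ≤ E[Γ(P, P) Γ(R, R)]`, where `Γ(R, R) = R N R - N(R²) / 2`, and the operator acting on
`R²` is moved onto `Γ(P, P)`, a polynomial of degree at most `2q` (`exists_Ex_gamma_sq_le`). Hence
only the `L⁴` norms of `R` and `N R` matter, and no Meyer inequality is needed. Since the generator
is closed (`ou_eq_of_tendsto`), this also shows that the series defining the generator of `X n * Y n`
converges.
-/

namespace WienerSpace

open MvPolynomial (pderiv)

/-! ### Polynomials in the coordinates -/

/-- Polynomials in the coordinates of the Wiener space. -/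
abbrev Poly : Type := MvPolynomial ℕ ℝ

/-- The number operator `N P = ∑ i, (x_i ∂_i P - ∂_i² P)` on polynomials, that is, the opposite of
the Ornstein–Uhlenbeck generator. -/
noncomputable def numOp (P : Poly) : Poly :=
  ∑ i ∈ P.vars, (MvPolynomial.X i * pderiv i P - pderiv i (pderiv i P))

/-- The carré du champ `Γ(P, Q) = ∑ i, ∂_i P ∂_i Q` on polynomials. The sum over the variables of
`P` is the full sum. -/
noncomputable def gamma (P Q : Poly) : Poly :=
  ∑ i ∈ P.vars, pderiv i P * pderiv i Q

lemma numOp_eq_sum {P : Poly} {S : Finset ℕ} (h : P.vars ⊆ S) :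
    numOp P = ∑ i ∈ S, (MvPolynomial.X i * pderiv i P - pderiv i (pderiv i P)) := by
  refine Finset.sum_subset h fun i _ hi => ?_
  simp [MvPolynomial.pderiv_eq_zero_of_notMem_vars hi]

lemma gamma_eq_sum {P : Poly} {S : Finset ℕ} (h : P.vars ⊆ S) (Q : Poly) :
    gamma P Q = ∑ i ∈ S, pderiv i P * pderiv i Q := by
  refine Finset.sum_subset h fun i _ hi => ?_
  simp [MvPolynomial.pderiv_eq_zero_of_notMem_vars hi]

lemma gamma_comm (P Q : Poly) : gamma P Q = gamma Q P := by
  rw [gamma_eq_sum (Finset.subset_union_left (s₂ := Q.vars)),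
    gamma_eq_sum (Finset.subset_union_right (s₁ := P.vars))]
  exact Finset.sum_congr rfl fun i _ => mul_comm _ _

lemma numOp_add (P Q : Poly) : numOp (P + Q) = numOp P + numOp Q := by
  rw [numOp_eq_sum (MvPolynomial.vars_add_subset P Q),
    numOp_eq_sum (Finset.subset_union_left (s₂ := Q.vars)),
    numOp_eq_sum (Finset.subset_union_right (s₁ := P.vars)), ← Finset.sum_add_distrib]
  refine Finset.sum_congr rfl fun i _ => ?_
  simp only [map_add]; ring

lemma numOp_smul (c : ℝ) (P : Poly) : numOp (c • P) = c • numOp P := by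
  have h : (c • P).vars ⊆ P.vars := by
    rw [MvPolynomial.smul_eq_C_mul]
    refine (MvPolynomial.vars_mul _ _).trans ?_
    simp
  rw [numOp_eq_sum h, numOp, Finset.smul_sum]
  refine Finset.sum_congr rfl fun i _ => ?_
  simp only [Derivation.map_smul, smul_sub, mul_smul_comm]

/-- The number operator as a linear map. -/
noncomputable def numOpL : Poly →ₗ[ℝ] Poly where
  toFun := numOp
  map_add' := numOp_add
  map_smul' := numOp_smul

lemma numOp_sub (P Q : Poly) : numOp (P - Q) = numOp P - numOp Q := numOpL.map_sub P Q

lemma numOp_sum {ι : Type*} (s : Finset ι) (P : ι → Poly) :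
    numOp (∑ i ∈ s, P i) = ∑ i ∈ s, numOp (P i) := map_sum numOpL P s

lemma gamma_neg_right (P Q : Poly) : gamma P (-Q) = -gamma P Q := by
  simp [gamma]

lemma gamma_add_right (P Q Q' : Poly) : gamma P (Q + Q') = gamma P Q + gamma P Q' := by
  simp [gamma, mul_add, Finset.sum_add_distrib]

lemma gamma_sub_right (P Q Q' : Poly) : gamma P (Q - Q') = gamma P Q - gamma P Q' := by
  rw [sub_eq_add_neg, gamma_add_right, gamma_neg_right, sub_eq_add_neg]

lemma gamma_sub_left (P P' Q : Poly) : gamma (P - P') Q = gamma P Q - gamma P' Q := by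
  rw [gamma_comm, gamma_sub_right, gamma_comm Q P, gamma_comm Q P']

/-- The Leibniz rule for the carré du champ. -/
lemma gamma_mul_left (P P' Q : Poly) :
    gamma (P * P') Q = P * gamma P' Q + P' * gamma P Q := by
  rw [gamma_eq_sum (MvPolynomial.vars_mul P P'),
    gamma_eq_sum (P := P) (Finset.subset_union_left (s₂ := P'.vars)),
    gamma_eq_sum (P := P') (Finset.subset_union_right (s₁ := P.vars)), Finset.mul_sum,
    Finset.mul_sum,
    ← Finset.sum_add_distrib]
  refine Finset.sum_congr rfl fun i _ => ?_
  rw [MvPolynomial.pderiv_mul]; ring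

lemma gamma_sq_left (P Q : Poly) : gamma (P ^ 2) Q = 2 * P * gamma P Q := by
  rw [sq, gamma_mul_left]; ring

lemma gamma_cube_left (P Q : Poly) : gamma (P ^ 3) Q = 3 * P ^ 2 * gamma P Q := by
  rw [pow_succ, gamma_mul_left, gamma_sq_left]; ring

lemma gamma_sq_sq (P : Poly) : gamma (P ^ 2) (P ^ 2) = 4 * (P ^ 2 * gamma P P) := by
  rw [gamma_sq_left, gamma_comm, gamma_sq_left]; ring

/-- `-N` is a diffusion operator with carré du champ `Γ`. -/
lemma numOp_mul (P Q : Poly) :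
    numOp (P * Q) = P * numOp Q + Q * numOp P - 2 * gamma P Q := by
  rw [numOp_eq_sum (MvPolynomial.vars_mul P Q),
    numOp_eq_sum (P := P) (Finset.subset_union_left (s₂ := Q.vars)),
    numOp_eq_sum (P := Q) (Finset.subset_union_right (s₁ := P.vars)),
    gamma_eq_sum (Finset.subset_union_left (s₂ := Q.vars)),
    Finset.mul_sum, Finset.mul_sum, Finset.mul_sum, ← Finset.sum_add_distrib,
    ← Finset.sum_sub_distrib]
  refine Finset.sum_congr rfl fun i _ => ?_
  simp only [MvPolynomial.pderiv_mul, map_add]; ring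

/-! ### Hermite polynomials in several variables -/

/-- The Hermite polynomial `H_n` in the variable `x_i`. -/
noncomputable def hermVar (i n : ℕ) : Poly :=
  Polynomial.aeval (MvPolynomial.X i) (Polynomial.hermite n)

lemma hermVar_zero (i : ℕ) : hermVar i 0 = 1 := by simp [hermVar]

lemma pderiv_hermVar (i j n : ℕ) :
    pderiv j (hermVar i n) = Polynomial.aeval (MvPolynomial.X i : Poly)
      (Polynomial.derivative (Polynomial.hermite n)) * pderiv j (MvPolynomial.X i) :=
  Derivation.map_aeval ((pderiv j).restrictScalars ℤ) _ _

lemma derivative_hermite_succ (n : ℕ) :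
    Polynomial.derivative (Polynomial.hermite (n + 1)) =
      ((n : Polynomial ℤ) + 1) * Polynomial.hermite n := by
  induction n with
  | zero => simp
  | succ n ih =>
    rw [Polynomial.hermite_succ (n + 1), Polynomial.derivative_sub, Polynomial.derivative_mul,
      Polynomial.derivative_X, ih, Polynomial.derivative_mul, Polynomial.hermite_succ n]
    simp only [Polynomial.derivative_add, Polynomial.derivative_natCast, Polynomial.derivative_one]
    push_cast; ring

lemma pderiv_hermVar_succ (i n : ℕ) :
    pderiv i (hermVar i (n + 1)) = ((n : Poly) + 1) * hermVar i n := by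
  rw [pderiv_hermVar, derivative_hermite_succ, MvPolynomial.pderiv_X_self]
  simp [hermVar]

lemma pderiv_hermVar_of_ne {i j : ℕ} (h : i ≠ j) (n : ℕ) : pderiv j (hermVar i n) = 0 := by
  rw [pderiv_hermVar, MvPolynomial.pderiv_X_of_ne h, mul_zero]

lemma hermVar_succ (i n : ℕ) :
    hermVar i (n + 1) = MvPolynomial.X i * hermVar i n - pderiv i (hermVar i n) := by
  rw [pderiv_hermVar, MvPolynomial.pderiv_X_self, hermVar, Polynomial.hermite_succ]
  simp [hermVar]

lemma hermVar_eigen (i n : ℕ) :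
    MvPolynomial.X i * pderiv i (hermVar i n) - pderiv i (pderiv i (hermVar i n)) =
      (n : ℝ) • hermVar i n := by
  cases n with
  | zero => simp [hermVar_zero]
  | succ n =>
    have h : pderiv i ((n : Poly) + 1) = 0 := by simp
    rw [pderiv_hermVar_succ, MvPolynomial.pderiv_mul, h, hermVar_succ, MvPolynomial.smul_eq_C_mul]
    push_cast
    simp only [map_add, map_natCast, map_one]
    ring

/-- The Hermite polynomial `∏ i, H_{k i}(x_i)`. -/
noncomputable def herm (k : ℕ →₀ ℕ) : Poly := k.prod hermVar

lemma herm_eq_mul (k : ℕ →₀ ℕ) (i : ℕ) : herm k = hermVar i (k i) * herm (k.erase i) :=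
  (Finsupp.mul_prod_erase' k i hermVar hermVar_zero).symm

lemma pderiv_herm_of_notMem {k : ℕ →₀ ℕ} {i : ℕ} (h : i ∉ k.support) :
    pderiv i (herm k) = 0 := by
  refine Finset.prod_induction _ (fun P : Poly => pderiv i P = 0) (fun P Q hP hQ => ?_) (by simp)
    fun j hj => pderiv_hermVar_of_ne (by rintro rfl; exact h hj) _
  rw [MvPolynomial.pderiv_mul, hP, hQ, zero_mul, mul_zero, add_zero]

lemma pderiv_herm (k : ℕ →₀ ℕ) (i : ℕ) :
    pderiv i (herm k) = pderiv i (hermVar i (k i)) * herm (k.erase i) := by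
  rw [herm_eq_mul k i, MvPolynomial.pderiv_mul, pderiv_herm_of_notMem (k := k.erase i) (by simp),
    mul_zero, add_zero]

lemma numOp_herm (k : ℕ →₀ ℕ) : numOp (herm k) = (k.degree : ℝ) • herm k := by
  have key : ∀ i, MvPolynomial.X i * pderiv i (herm k) - pderiv i (pderiv i (herm k)) =
      (k i : ℝ) • herm k := by
    intro i
    have h1 : pderiv i (pderiv i (herm k)) =
        pderiv i (pderiv i (hermVar i (k i))) * herm (k.erase i) := by
      rw [pderiv_herm, MvPolynomial.pderiv_mul,
        pderiv_herm_of_notMem (k := k.erase i) (by simp), mul_zero, add_zero]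
    rw [h1, pderiv_herm, ← mul_assoc, ← sub_mul, hermVar_eigen, smul_mul_assoc, ← herm_eq_mul]
  rw [numOp_eq_sum (P := herm k) (S := (herm k).vars ∪ k.support) Finset.subset_union_left]
  simp_rw [key]
  have hsum : ∑ i ∈ k.support, (k i : ℝ) = ∑ i ∈ (herm k).vars ∪ k.support, (k i : ℝ) :=
    Finset.sum_subset Finset.subset_union_right fun i _ hi => by simpa using hi
  rw [← Finset.sum_smul, ← hsum, Finsupp.degree_apply, Nat.cast_sum]

/-- The span of the Hermite polynomials of degree exactly `m`. -/
noncomputable def eig (m : ℕ) : Submodule ℝ Poly :=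
  Submodule.span ℝ {P | ∃ k : ℕ →₀ ℕ, k.degree = m ∧ P = herm k}

lemma herm_mem_eig (k : ℕ →₀ ℕ) : herm k ∈ eig k.degree :=
  Submodule.subset_span ⟨k, rfl, rfl⟩

lemma numOp_of_mem_eig {m : ℕ} {P : Poly} (h : P ∈ eig m) : numOp P = (m : ℝ) • P := by
  induction h using Submodule.span_induction with
  | mem P hP => obtain ⟨k, rfl, rfl⟩ := hP; exact numOp_herm k
  | zero => simp [numOp]
  | add P Q _ _ hP hQ => rw [numOp_add, hP, hQ, smul_add]
  | smul c P _ hP => rw [numOp_smul, hP, smul_comm]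

lemma exists_eq_C_of_mem_eig_zero {P : Poly} (h : P ∈ eig 0) : ∃ c : ℝ, P = MvPolynomial.C c := by
  induction h using Submodule.span_induction with
  | mem P hP =>
    obtain ⟨k, hk, rfl⟩ := hP
    refine ⟨1, ?_⟩
    rw [Finsupp.degree_eq_zero_iff] at hk
    simp [hk, herm]
  | zero => exact ⟨0, by simp⟩
  | add P Q _ _ hP hQ =>
    obtain ⟨a, rfl⟩ := hP
    obtain ⟨b, rfl⟩ := hQ
    exact ⟨a + b, by simp⟩
  | smul c P _ hP =>
    obtain ⟨a, rfl⟩ := hP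
    exact ⟨c * a, by simp [MvPolynomial.smul_eq_C_mul]⟩

lemma totalDegree_hermVar_le (i n : ℕ) : (hermVar i n).totalDegree ≤ n := by
  rw [hermVar, Polynomial.aeval_eq_sum_range, Polynomial.natDegree_hermite]
  refine MvPolynomial.totalDegree_finsetSum_le fun j hj => ?_
  have hj : j ≤ n := by simpa [Nat.lt_succ_iff] using hj
  rw [zsmul_eq_mul, ← map_intCast (MvPolynomial.C : ℝ →+* Poly), ← MvPolynomial.smul_eq_C_mul]
  refine (MvPolynomial.totalDegree_smul_le _ _).trans ?_
  simpa using hj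

lemma totalDegree_herm_le (k : ℕ →₀ ℕ) : (herm k).totalDegree ≤ k.degree := by
  rw [herm, Finsupp.prod, Finsupp.degree]
  exact (MvPolynomial.totalDegree_finsetProd _ _).trans
    (Finset.sum_le_sum fun i _ => totalDegree_hermVar_le i _)

lemma totalDegree_le_of_mem_eig {m : ℕ} {P : Poly} (h : P ∈ eig m) : P.totalDegree ≤ m := by
  have : eig m ≤ MvPolynomial.restrictTotalDegree ℕ ℝ m := by
    refine Submodule.span_le.2 ?_
    rintro P ⟨k, rfl, rfl⟩
    exact (MvPolynomial.mem_restrictTotalDegree _ _ _).2 (totalDegree_herm_le k)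
  exact (MvPolynomial.mem_restrictTotalDegree _ _ _).1 (this h)

lemma herm_mem_iSup_eig {k : ℕ →₀ ℕ} {b : ℕ} (h : k.degree < b) :
    herm k ∈ ⨆ m ∈ Finset.range b, eig m :=
  (le_iSup₂ (f := fun m (_ : m ∈ Finset.range b) => eig m) k.degree (Finset.mem_range.2 h))
    (herm_mem_eig k)

/-- The three-term recurrence, in one of the variables. -/
lemma X_mul_herm_mem (k : ℕ →₀ ℕ) (i : ℕ) :
    MvPolynomial.X i * herm k ∈ ⨆ m ∈ Finset.range (k.degree + 2), eig m := by
  have h1 : MvPolynomial.X i * herm k =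
      herm (k + Finsupp.single i 1) + pderiv i (hermVar i (k i)) * herm (k.erase i) := by
    have he : (k + Finsupp.single i 1).erase i = k.erase i := by
      ext j
      by_cases hj : j = i
      · simp [hj]
      · simp [Finsupp.erase_ne hj]
    rw [herm_eq_mul (k + Finsupp.single i 1) i, he]
    simp only [Finsupp.add_apply, Finsupp.single_eq_same]
    rw [hermVar_succ, herm_eq_mul k i]
    ring
  rw [h1]
  refine Submodule.add_mem _ ?_ ?_
  · refine herm_mem_iSup_eig ?_
    rw [map_add, Finsupp.degree_single]
    omega
  · rcases hk : k i with _ | n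
    · simp [hermVar_zero]
    · have h2 : herm (k - Finsupp.single i 1) = hermVar i n * herm (k.erase i) := by
        have he : (k - Finsupp.single i 1).erase i = k.erase i := by
          ext j
          by_cases hj : j = i
          · simp [hj]
          · simp [Finsupp.erase_ne hj, Ne.symm hj]
        rw [herm_eq_mul (k - Finsupp.single i 1) i, he]
        simp [hk]
      rw [pderiv_hermVar_succ, mul_assoc, ← h2]
      have h3 : ((n : Poly) + 1) * herm (k - Finsupp.single i 1) =
          ((n : ℝ) + 1) • herm (k - Finsupp.single i 1) := by
        rw [MvPolynomial.smul_eq_C_mul]; simp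
      rw [h3]
      have := Finsupp.degree_mono (tsub_le_self : k - Finsupp.single i 1 ≤ k)
      exact Submodule.smul_mem _ _ (herm_mem_iSup_eig (by omega))

lemma iSup_eig_mono {a b : ℕ} (h : a ≤ b) :
    (⨆ m ∈ Finset.range a, eig m) ≤ ⨆ m ∈ Finset.range b, eig m :=
  biSup_mono fun _ hm => Finset.range_mono h hm

lemma X_mul_mem {d : ℕ} {P : Poly} (i : ℕ) (h : P ∈ ⨆ m ∈ Finset.range (d + 1), eig m) :
    MvPolynomial.X i * P ∈ ⨆ m ∈ Finset.range (d + 2), eig m := by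
  have : (⨆ m ∈ Finset.range (d + 1), eig m) ≤
      (⨆ m ∈ Finset.range (d + 2), eig m).comap (LinearMap.mulLeft ℝ (MvPolynomial.X i : Poly)) := by
    refine iSup₂_le fun m hm => Submodule.span_le.2 ?_
    rintro P ⟨k, rfl, rfl⟩
    have hm : k.degree < d + 1 := Finset.mem_range.1 hm
    exact iSup_eig_mono (by omega) (X_mul_herm_mem k i)
  exact this h

/-- Every polynomial of degree at most `d` is a combination of Hermite polynomials of degree at most
`d`. -/
lemma mem_iSup_eig_of_totalDegree_le {d : ℕ} {P : Poly} (h : P.totalDegree ≤ d) :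
    P ∈ ⨆ m ∈ Finset.range (d + 1), eig m := by
  have mono : ∀ n, ∀ k : ℕ →₀ ℕ, k.degree = n →
      MvPolynomial.monomial k (1 : ℝ) ∈ ⨆ m ∈ Finset.range (n + 1), eig m := by
    intro n
    induction n with
    | zero =>
      intro k hk
      rw [Finsupp.degree_eq_zero_iff] at hk
      subst hk
      simpa [herm] using herm_mem_iSup_eig (k := 0) (b := 0 + 1) (by simp)
    | succ n ih =>
      intro k hk
      obtain ⟨i, hi⟩ : ∃ i, k i ≠ 0 := by
        by_contra! h0
        have : k = 0 := Finsupp.ext h0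
        simp [this] at hk
      have hk' : k = Finsupp.single i 1 + (k - Finsupp.single i 1) := by
        rw [add_tsub_cancel_of_le]
        simpa [Finsupp.single_le_iff] using Nat.one_le_iff_ne_zero.2 hi
      have hd : (k - Finsupp.single i 1).degree = n := by
        have := congrArg Finsupp.degree hk'
        rw [map_add, Finsupp.degree_single, hk] at this
        omega
      have : MvPolynomial.monomial k (1 : ℝ) =
          MvPolynomial.X i * MvPolynomial.monomial (k - Finsupp.single i 1) (1 : ℝ) := by
        conv_lhs => rw [hk']
        rw [MvPolynomial.X, MvPolynomial.monomial_mul, one_mul]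
      rw [this]
      exact X_mul_mem i (ih _ hd)
  rw [P.as_sum]
  refine Submodule.sum_mem _ fun k hk => ?_
  have hkd : k.degree ≤ d := (MvPolynomial.le_totalDegree hk).trans h
  have : MvPolynomial.monomial k (P.coeff k) = P.coeff k • MvPolynomial.monomial k (1 : ℝ) := by
    simp [MvPolynomial.smul_monomial]
  rw [this]
  exact Submodule.smul_mem _ _ (iSup_eig_mono (by omega) (mono _ k rfl))

/-- The Hermite expansion of a polynomial. -/
lemma exists_eig_decomp {d : ℕ} {P : Poly} (h : P.totalDegree ≤ d) :
    ∃ c : ℕ → Poly, (∀ m, c m ∈ eig m) ∧ P = ∑ m ∈ Finset.range (d + 1), c m := by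
  obtain ⟨c, hc⟩ := (Submodule.mem_iSup_finset_iff_exists_sum _ _).1
    (mem_iSup_eig_of_totalDegree_le h)
  exact ⟨fun m => c m, fun m => (c m).2, hc.symm⟩

lemma totalDegree_pderiv_le (i : ℕ) {d : ℕ} {P : Poly} (h : P.totalDegree ≤ d + 1) :
    (pderiv i P).totalDegree ≤ d := by
  have h1 : pderiv i P = ∑ k ∈ P.support, pderiv i (MvPolynomial.monomial k (P.coeff k)) := by
    conv_lhs => rw [P.as_sum, map_sum]
  rw [h1]
  refine MvPolynomial.totalDegree_finsetSum_le fun k hk => ?_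
  rw [MvPolynomial.pderiv_monomial]
  by_cases hi : k i = 0
  · simp [hi]
  refine (MvPolynomial.totalDegree_monomial_le _ _).trans ?_
  have hkd : k.degree ≤ d + 1 := (MvPolynomial.le_totalDegree hk).trans h
  have hk' : k = Finsupp.single i 1 + (k - Finsupp.single i 1) := by
    rw [add_tsub_cancel_of_le]
    simpa [Finsupp.single_le_iff] using Nat.one_le_iff_ne_zero.2 hi
  have := congrArg Finsupp.degree hk'
  rw [map_add, Finsupp.degree_single] at this
  change (k - Finsupp.single i 1).degree ≤ d
  omega

lemma totalDegree_eq_zero_iff_C {P : Poly} (h : P.totalDegree ≤ 0) :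
    P = MvPolynomial.C (P.coeff 0) :=
  MvPolynomial.totalDegree_eq_zero_iff_eq_C.1 (Nat.le_zero.1 h)

/-! ### Gaussian integration by parts -/

lemma hasDerivAt_gaussianPDFReal (x : ℝ) :
    HasDerivAt (gaussianPDFReal 0 1) (-x * gaussianPDFReal 0 1 x) x := by
  have h : gaussianPDFReal 0 1 =
      fun x => (√(2 * Real.pi * (1 : ℝ≥0)))⁻¹ * Real.exp (-(x - 0) ^ 2 / (2 * (1 : ℝ≥0))) := by
    ext x; rw [gaussianPDFReal_def]
  rw [h]
  have h1 : HasDerivAt (fun x : ℝ => -(x - 0) ^ 2 / (2 * ((1 : ℝ≥0) : ℝ))) (-x) x := by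
    have := (((hasDerivAt_id x).sub_const 0).pow 2).neg.div_const (2 * ((1 : ℝ≥0) : ℝ))
    refine this.congr_deriv ?_
    simp
    ring
  refine (h1.exp.const_mul _).congr_deriv ?_
  ring

lemma integrable_gaussianReal_iff {E : Type*} [NormedAddCommGroup E] [NormedSpace ℝ E]
    {f : ℝ → E} :
    Integrable f (gaussianReal 0 1) ↔ Integrable fun x => gaussianPDFReal 0 1 x • f x := by
  rw [gaussianReal_of_var_ne_zero _ one_ne_zero,
    integrable_withDensity_iff_integrable_smul' (measurable_gaussianPDF 0 1)
      (ae_of_all _ fun _ => gaussianPDF_lt_top)]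
  simp only [toReal_gaussianPDF]

/-- Stein's identity for the standard Gaussian law. -/
lemma integral_gaussianReal_deriv {E : Type*} [NormedAddCommGroup E] [NormedSpace ℝ E]
    {u u' : ℝ → E} (hu : ∀ x, HasDerivAt u (u' x) x)
    (h0 : Integrable u (gaussianReal 0 1)) (h1 : Integrable u' (gaussianReal 0 1))
    (h2 : Integrable (fun x => x • u x) (gaussianReal 0 1)) :
    ∫ x, u' x ∂gaussianReal 0 1 = ∫ x, x • u x ∂gaussianReal 0 1 := by
  rw [← sub_eq_zero, ← integral_sub h1 h2, integral_gaussianReal_eq_integral_smul one_ne_zero]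
  have h12 := integrable_gaussianReal_iff.1 (h1.sub h2)
  refine integral_eq_zero_of_hasDerivAt_of_integrable (f := fun x => gaussianPDFReal 0 1 x • u x)
    (fun x => ?_) h12 (integrable_gaussianReal_iff.1 h0)
  refine ((hasDerivAt_gaussianPDFReal x).smul (hu x)).congr_deriv ?_
  rw [smul_sub, smul_smul, neg_mul, neg_smul, mul_comm x, ← sub_eq_add_neg]

/-- Resampling one coordinate preserves the Wiener measure. -/
lemma measurePreserving_update (i : ℕ) :
    MeasurePreserving (fun p : (ℕ → ℝ) × ℝ => Function.update p.1 i p.2)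
      (wiener.prod (gaussianReal 0 1)) wiener := by
  have hm : Measurable (fun p : (ℕ → ℝ) × ℝ => Function.update p.1 i p.2) := by
    refine measurable_pi_iff.2 fun j => ?_
    by_cases hj : j = i
    · subst hj; simpa using measurable_snd
    · simp only [Function.update_of_ne hj]; fun_prop
  refine ⟨hm, Measure.eq_infinitePi _ fun s t ht => ?_⟩
  rw [Measure.map_apply hm (MeasurableSet.pi s.countable_toSet fun i _ => ht i)]
  have hpre : (fun p : (ℕ → ℝ) × ℝ => Function.update p.1 i p.2) ⁻¹' (Set.pi s t) =
      (Set.pi (s.erase i) t) ×ˢ (if i ∈ s then t i else Set.univ) := by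
    ext ⟨ω, x⟩
    simp only [Set.mem_preimage, Set.mem_pi, Finset.mem_coe, Set.mem_prod, Finset.mem_erase]
    constructor
    · intro h
      refine ⟨fun j hj => by simpa [hj.1] using h j hj.2, ?_⟩
      split_ifs with hi
      · simpa using h i hi
      · trivial
    · rintro ⟨h1, h2⟩ j hj
      by_cases hji : j = i
      · subst hji; simpa [hj] using h2
      · simpa [hji] using h1 j ⟨hji, hj⟩
  rw [hpre, Measure.prod_prod, wiener, Measure.infinitePi_pi _ fun i _ => ht i]
  split_ifs with hi
  · rw [mul_comm, Finset.mul_prod_erase s (fun j => gaussianReal 0 1 (t j)) hi]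
  · rw [Finset.erase_eq_of_notMem hi, measure_univ, mul_one]

/-- Gaussian integration by parts in one coordinate of the Wiener space. -/
lemma integral_wiener_deriv {E : Type*} [NormedAddCommGroup E] [NormedSpace ℝ E]
    [MeasurableSpace E] [BorelSpace E]
    {F F' : (ℕ → ℝ) → E} (i : ℕ)
    (hF : ∀ ω, HasDerivAt (fun x => F (Function.update ω i x)) (F' ω) (ω i))
    (h0 : Integrable F wiener) (h1 : Integrable F' wiener)
    (h2 : Integrable (fun ω => ω i • F ω) wiener) :
    ∫ ω, F' ω ∂wiener = ∫ ω, ω i • F ω ∂wiener := by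
  have mp := measurePreserving_update i
  have key : ∀ G : (ℕ → ℝ) → E, Integrable G wiener →
      Integrable (fun p : (ℕ → ℝ) × ℝ => G (Function.update p.1 i p.2))
        (wiener.prod (gaussianReal 0 1)) ∧
      ∫ ω, G ω ∂wiener =
        ∫ ω, ∫ x, G (Function.update ω i x) ∂gaussianReal 0 1 ∂wiener := by
    intro G hG
    have hG' : Integrable (fun p : (ℕ → ℝ) × ℝ => G (Function.update p.1 i p.2))
        (wiener.prod (gaussianReal 0 1)) := by
      rw [← mp.map_eq] at hG
      exact hG.comp_measurable mp.measurable
    refine ⟨hG', ?_⟩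
    rw [← integral_prod _ hG']
    rw [← mp.map_eq] at hG
    conv_lhs => rw [← mp.map_eq]
    exact integral_map mp.measurable.aemeasurable hG.aestronglyMeasurable
  rw [(key _ h1).2, (key _ h2).2]
  refine integral_congr_ae ?_
  filter_upwards [(key _ h0).1.prod_right_ae, (key _ h1).1.prod_right_ae,
    (key _ h2).1.prod_right_ae] with ω i0 i1 i2
  simp only [Function.update_self] at i2 ⊢
  refine integral_gaussianReal_deriv (fun x => ?_) i0 i1 i2
  simpa using hF (Function.update ω i x)

/-! ### Polynomials as random variables -/

/-- The random variable defined by a polynomial. -/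
noncomputable def ev (P : Poly) (ω : ℕ → ℝ) : ℝ := MvPolynomial.eval ω P

@[simp] lemma ev_add (P Q : Poly) (ω : ℕ → ℝ) : ev (P + Q) ω = ev P ω + ev Q ω := by simp [ev]
@[simp] lemma ev_sub (P Q : Poly) (ω : ℕ → ℝ) : ev (P - Q) ω = ev P ω - ev Q ω := by simp [ev]
@[simp] lemma ev_mul (P Q : Poly) (ω : ℕ → ℝ) : ev (P * Q) ω = ev P ω * ev Q ω := by simp [ev]
@[simp] lemma ev_pow (P : Poly) (n : ℕ) (ω : ℕ → ℝ) : ev (P ^ n) ω = ev P ω ^ n := by simp [ev]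
@[simp] lemma ev_smul (c : ℝ) (P : Poly) (ω : ℕ → ℝ) : ev (c • P) ω = c * ev P ω := by simp [ev]
@[simp] lemma ev_C (c : ℝ) (ω : ℕ → ℝ) : ev (MvPolynomial.C c) ω = c := by simp [ev]
@[simp] lemma ev_X (i : ℕ) (ω : ℕ → ℝ) : ev (MvPolynomial.X i) ω = ω i := by simp [ev]
@[simp] lemma ev_sum {ι : Type*} (s : Finset ι) (P : ι → Poly) (ω : ℕ → ℝ) :
    ev (∑ i ∈ s, P i) ω = ∑ i ∈ s, ev (P i) ω := by simp [ev]

lemma measurable_ev (P : Poly) : Measurable (ev P) := by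
  induction P using MvPolynomial.induction_on with
  | C a => simp [funext (ev_C a)]
  | add P Q hP hQ => simpa only [funext (ev_add P Q)] using hP.fun_add hQ
  | mul_X P i hP =>
    simpa only [funext (ev_mul P _), ev_X] using hP.fun_mul (measurable_pi_apply i)

lemma memLp_coord (i : ℕ) {p : ℝ≥0∞} (hp : p ≠ ∞) : MemLp (fun ω : ℕ → ℝ => ω i) p wiener :=
  (memLp_id_gaussianReal' p hp).comp_measurePreserving
    (measurePreserving_eval_infinitePi (fun _ : ℕ => gaussianReal 0 1) i)

lemma memLp_ev (P : Poly) {p : ℝ≥0∞} (hp : p ≠ ∞) : MemLp (ev P) p wiener := by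
  induction P using MvPolynomial.induction_on generalizing p with
  | C a => simpa [funext (ev_C a)] using memLp_const a
  | add P Q hP hQ => exact (funext (ev_add P Q)) ▸ (hP hp).add (hQ hp)
  | mul_X P i hP =>
    have h2 : 2 * p ≠ ∞ := ENNReal.mul_ne_top (by simp) hp
    have : ENNReal.HolderTriple (2 * p) (2 * p) p := ⟨by
      rw [ENNReal.mul_inv (by simp) (by simp), ← add_mul, ENNReal.inv_two_add_inv_two, one_mul]⟩
    simpa [funext (ev_mul P _)] using (memLp_coord i h2).mul' (hP h2)

lemma integrable_ev (P : Poly) : Integrable (ev P) wiener :=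
  memLp_one_iff_integrable.1 (memLp_ev P (by simp))

lemma hasDerivAt_ev (P : Poly) (i : ℕ) (ω : ℕ → ℝ) :
    HasDerivAt (fun x => ev P (Function.update ω i x)) (ev (pderiv i P) ω) (ω i) := by
  induction P using MvPolynomial.induction_on with
  | C a => simpa [ev] using hasDerivAt_const (ω i) a
  | add P Q hP hQ => simpa using hP.fun_add hQ
  | mul_X P j hP =>
    have hX : HasDerivAt (fun x => Function.update ω i x j)
        (ev (pderiv i (MvPolynomial.X j)) ω) (ω i) := by
      by_cases hj : j = i
      · subst hj
        simpa [ev] using hasDerivAt_id' (ω j)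
      · simpa [hj, MvPolynomial.pderiv_X_of_ne hj, ev] using hasDerivAt_const (ω i) (ω j)
    have := hP.mul hX
    simp only [Function.update_eq_self] at this
    refine (this.congr_deriv ?_).congr_of_eventuallyEq (Eventually.of_forall fun x => by simp)
    rw [MvPolynomial.pderiv_mul]
    simp only [ev_add, ev_mul, ev_X]

/-- Integration by parts for the number operator against a random variable `h` with partial
derivatives `dh i`. -/
lemma integral_numOp_smul {E : Type*} [NormedAddCommGroup E] [NormedSpace ℝ E]
    [MeasurableSpace E] [BorelSpace E]
    (P : Poly) {h : (ℕ → ℝ) → E} {dh : ℕ → (ℕ → ℝ) → E}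
    (hd : ∀ i ω, HasDerivAt (fun x => h (Function.update ω i x)) (dh i ω) (ω i))
    (h0 : ∀ Q : Poly, Integrable (fun ω => ev Q ω • h ω) wiener)
    (h1 : ∀ (Q : Poly) (i : ℕ), Integrable (fun ω => ev Q ω • dh i ω) wiener) :
    ∫ ω, ev (numOp P) ω • h ω ∂wiener =
      ∫ ω, ∑ i ∈ P.vars, ev (pderiv i P) ω • dh i ω ∂wiener := by
  simp only [numOp, ev_sum, Finset.sum_smul]
  rw [integral_finsetSum _ fun i _ => h0 (_ - _), integral_finsetSum _ fun i _ => h1 _ i]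
  refine Finset.sum_congr rfl fun i _ => ?_
  have hI := integral_wiener_deriv i (F := fun ω => ev (pderiv i P) ω • h ω)
    (F' := fun ω => ev (pderiv i P) ω • dh i ω + ev (pderiv i (pderiv i P)) ω • h ω)
    (fun ω => by
      have := (hasDerivAt_ev (pderiv i P) i ω).fun_smul (hd i ω)
      simpa using this)
    (h0 _) ((h1 _ i).add (h0 _)) (by
      have := h0 (MvPolynomial.X i * pderiv i P)
      simpa [smul_smul] using this)
  rw [integral_add (h1 _ i) (h0 _), ← eq_sub_iff_add_eq, ← integral_sub ?_ (h0 _)] at hI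
  · rw [hI]
    refine integral_congr_ae (ae_of_all _ fun ω => ?_)
    simp [sub_smul, smul_smul]
  · have := h0 (MvPolynomial.X i * pderiv i P)
    simpa [smul_smul] using this

lemma integral_ev_mul_numOp (P Q : Poly) :
    ∫ ω, ev (numOp P * Q) ω ∂wiener = ∫ ω, ev (gamma P Q) ω ∂wiener := by
  have := integral_numOp_smul P (h := ev Q) (dh := fun i => ev (pderiv i Q))
    (fun i ω => hasDerivAt_ev Q i ω)
    (fun R => by simpa [funext (ev_mul R Q)] using integrable_ev (R * Q))
    (fun R i => by simpa [funext (ev_mul R _)] using integrable_ev (R * pderiv i Q))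
  simpa [gamma] using this

/-! ### Moments of polynomials -/

/-- The expectation of a polynomial, as a linear form. -/
noncomputable def Ex : Poly →ₗ[ℝ] ℝ where
  toFun P := ∫ ω, ev P ω ∂wiener
  map_add' P Q := by
    simp only [ev_add]
    exact integral_add (integrable_ev P) (integrable_ev Q)
  map_smul' c P := by
    simp only [ev_smul, RingHom.id_apply, smul_eq_mul]
    exact integral_const_mul c _

lemma Ex_def (P : Poly) : Ex P = ∫ ω, ev P ω ∂wiener := rfl

lemma Ex_C (c : ℝ) : Ex (MvPolynomial.C c) = c := by simp [Ex_def]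

lemma Ex_le {P Q : Poly} (h : ∀ ω, ev P ω ≤ ev Q ω) : Ex P ≤ Ex Q :=
  integral_mono (integrable_ev P) (integrable_ev Q) h

lemma Ex_nonneg {P : Poly} (h : ∀ ω, 0 ≤ ev P ω) : 0 ≤ Ex P := integral_nonneg h

lemma Ex_sq_nonneg (P : Poly) : 0 ≤ Ex (P ^ 2) := Ex_nonneg fun ω => by simpa using sq_nonneg _

lemma Ex_pow_four_nonneg (P : Poly) : 0 ≤ Ex (P ^ 4) :=
  Ex_nonneg fun ω => by rw [ev_pow]; positivity

lemma Ex_mul_sq_le (P Q : Poly) : Ex (P * Q) ^ 2 ≤ Ex (P ^ 2) * Ex (Q ^ 2) := by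
  have h : ∀ t : ℝ, 0 ≤ Ex (Q ^ 2) * (t * t) + 2 * Ex (P * Q) * t + Ex (P ^ 2) := by
    intro t
    have h1 : (P + t • Q) ^ 2 = (t * t) • Q ^ 2 + (2 * t) • (P * Q) + P ^ 2 := by
      simp only [MvPolynomial.smul_eq_C_mul, map_mul, map_ofNat]; ring
    have h2 := Ex_sq_nonneg (P + t • Q)
    rw [h1, map_add, map_add, map_smul, map_smul, smul_eq_mul, smul_eq_mul] at h2
    linarith
  have := discrim_le_zero h
  rw [discrim] at this
  nlinarith

lemma abs_Ex_mul_le (P Q : Poly) : |Ex (P * Q)| ≤ √(Ex (P ^ 2)) * √(Ex (Q ^ 2)) := by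
  rw [← Real.sqrt_mul (Ex_sq_nonneg P)]
  exact Real.abs_le_sqrt (Ex_mul_sq_le P Q)

lemma Ex_sq_mul_sq_le (P Q : Poly) : Ex (P ^ 2 * Q ^ 2) ≤ √(Ex (P ^ 4)) * √(Ex (Q ^ 4)) := by
  have := (le_abs_self _).trans (abs_Ex_mul_le (P ^ 2) (Q ^ 2))
  simpa only [← pow_mul] using this

lemma Ex_numOp_mul (P Q : Poly) : Ex (numOp P * Q) = Ex (gamma P Q) := integral_ev_mul_numOp P Q

/-- The number operator is symmetric. -/
lemma Ex_numOp_mul_comm (P Q : Poly) : Ex (numOp P * Q) = Ex (P * numOp Q) := by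
  rw [Ex_numOp_mul, gamma_comm, ← Ex_numOp_mul, mul_comm]

lemma Ex_mul_eq_zero_of_mem_eig {m n : ℕ} (hmn : m ≠ n) {P Q : Poly} (hP : P ∈ eig m)
    (hQ : Q ∈ eig n) : Ex (P * Q) = 0 := by
  have h := Ex_numOp_mul_comm P Q
  rw [numOp_of_mem_eig hP, numOp_of_mem_eig hQ, smul_mul_assoc, mul_smul_comm, map_smul, map_smul,
    smul_eq_mul, smul_eq_mul, ← sub_eq_zero, ← sub_mul, mul_eq_zero, sub_eq_zero] at h
  exact h.resolve_left (by exact_mod_cast hmn)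

lemma one_mem_eig_zero : (1 : Poly) ∈ eig 0 := by
  simpa [herm] using herm_mem_eig 0

lemma Ex_eq_zero_of_mem_eig {m : ℕ} (hm : m ≠ 0) {P : Poly} (hP : P ∈ eig m) : Ex P = 0 := by
  simpa using Ex_mul_eq_zero_of_mem_eig hm hP one_mem_eig_zero

/-- Parseval's identity for Hermite expansions. -/
lemma Ex_sum_mul_sum {c : ℕ → Poly} (hc : ∀ m, c m ∈ eig m) (a b : ℕ → ℝ) (s : Finset ℕ) :
    Ex ((∑ m ∈ s, a m • c m) * ∑ m ∈ s, b m • c m) = ∑ m ∈ s, a m * b m * Ex (c m ^ 2) := by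
  rw [Finset.sum_mul_sum, map_sum]
  refine Finset.sum_congr rfl fun m hm => ?_
  rw [map_sum, Finset.sum_eq_single m]
  · rw [smul_mul_smul_comm, map_smul, smul_eq_mul, sq]
  · intro n _ hn
    rw [smul_mul_smul_comm, map_smul, Ex_mul_eq_zero_of_mem_eig hn.symm (hc m) (hc n), smul_zero]
  · exact fun h => absurd hm h

lemma numOp_sum_smul {c : ℕ → Poly} (hc : ∀ m, c m ∈ eig m) (a : ℕ → ℝ) (s : Finset ℕ) :
    numOp (∑ m ∈ s, a m • c m) = ∑ m ∈ s, (m * a m) • c m := by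
  rw [numOp_sum]
  refine Finset.sum_congr rfl fun m _ => ?_
  rw [numOp_smul, numOp_of_mem_eig (hc m), smul_smul, mul_comm]

/-- The Gaussian Poincaré inequality. -/
lemma Ex_sq_sub_sq_Ex_le (F : Poly) : Ex (F ^ 2) - Ex F ^ 2 ≤ Ex (gamma F F) := by
  obtain ⟨c, hc, hF⟩ := exists_eig_decomp (le_refl F.totalDegree)
  set s := Finset.range (F.totalDegree + 1)
  have hF1 : F = ∑ m ∈ s, (1 : ℝ) • c m := by simpa using hF
  have hNF : numOp F = ∑ m ∈ s, (m * 1 : ℝ) • c m := by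
    conv_lhs => rw [hF1]
    rw [numOp_sum_smul hc]
  have e1 : Ex (F ^ 2) = ∑ m ∈ s, Ex (c m ^ 2) := by
    rw [sq]
    conv_lhs => rw [hF1]
    rw [Ex_sum_mul_sum hc]; simp
  have e2 : Ex (gamma F F) = ∑ m ∈ s, (m : ℝ) * Ex (c m ^ 2) := by
    rw [← Ex_numOp_mul, hNF]
    conv_lhs => rw [hF1]
    rw [Ex_sum_mul_sum hc]; simp
  have h0 : (0 : ℕ) ∈ s := by simp [s]
  have e3 : Ex F ^ 2 = Ex (c 0 ^ 2) := by
    have : Ex F = Ex (c 0) := by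
      rw [hF, map_sum, Finset.sum_eq_single 0]
      · intro m _ hm
        exact Ex_eq_zero_of_mem_eig hm (hc m)
      · exact fun h => absurd h0 h
    obtain ⟨a, ha⟩ := exists_eq_C_of_mem_eig_zero (hc 0)
    rw [this, ha, ← map_pow (MvPolynomial.C : ℝ →+* Poly), Ex_C, Ex_C]
  rw [e1, e2, e3, ← Finset.add_sum_erase s _ h0, add_sub_cancel_left]
  refine (Finset.sum_le_sum fun m hm => ?_).trans (Finset.sum_le_sum_of_subset_of_nonneg
    (Finset.erase_subset 0 s) fun m _ _ => mul_nonneg m.cast_nonneg (Ex_sq_nonneg _))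
  have hm1 : (1 : ℝ) ≤ m := by
    exact_mod_cast Nat.one_le_iff_ne_zero.2 (Finset.ne_of_mem_erase hm)
  nlinarith [Ex_sq_nonneg (c m)]

lemma Ex_gamma_self_le {d : ℕ} {P : Poly} (h : P.totalDegree ≤ d) :
    Ex (gamma P P) ≤ d * Ex (P ^ 2) := by
  obtain ⟨c, hc, hP⟩ := exists_eig_decomp h
  have hP1 : P = ∑ m ∈ Finset.range (d + 1), (1 : ℝ) • c m := by simpa using hP
  have hNP : numOp P = ∑ m ∈ Finset.range (d + 1), (m * 1 : ℝ) • c m := by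
    conv_lhs => rw [hP1]
    rw [numOp_sum_smul hc]
  rw [← Ex_numOp_mul, sq, hNP]
  rw [hP1, Ex_sum_mul_sum hc, Ex_sum_mul_sum hc, Finset.mul_sum]
  refine Finset.sum_le_sum fun m hm => ?_
  have hm : (m : ℝ) ≤ d := by exact_mod_cast Nat.lt_succ_iff.1 (Finset.mem_range.1 hm)
  nlinarith [Ex_sq_nonneg (c m)]

/-- Hypercontractivity: on polynomials of bounded degree, the fourth moment is controlled by the
second one, uniformly in the number of variables. The Poincaré inequality for `P²` reduces the claim
to the partial derivatives of `P`, which have smaller degree. -/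
lemma exists_Ex_pow_four_le (d : ℕ) :
    ∃ C : ℝ, 0 ≤ C ∧ ∀ P : Poly, P.totalDegree ≤ d → Ex (P ^ 4) ≤ C * Ex (P ^ 2) ^ 2 := by
  induction d with
  | zero =>
    refine ⟨1, zero_le_one, fun P hP => ?_⟩
    rw [totalDegree_eq_zero_iff_C hP, ← map_pow (MvPolynomial.C : ℝ →+* Poly),
      ← map_pow (MvPolynomial.C : ℝ →+* Poly), Ex_C, Ex_C]
    exact le_of_eq (by ring)
  | succ d ih =>
    obtain ⟨C, hC, ih⟩ := ih
    refine ⟨2 + 16 * C * (d + 1) ^ 2, by positivity, fun P hP => ?_⟩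
    set M := √(Ex (P ^ 4)) with hM
    have hM2 : M ^ 2 = Ex (P ^ 4) := Real.sq_sqrt (Ex_pow_four_nonneg P)
    have hM0 : 0 ≤ M := Real.sqrt_nonneg _
    have h1 : Ex (P ^ 4) ≤ Ex (P ^ 2) ^ 2 + 4 * Ex (P ^ 2 * gamma P P) := by
      have h2 := Ex_sq_sub_sq_Ex_le (P ^ 2)
      have h4 : (4 * (P ^ 2 * gamma P P) : Poly) = (4 : ℝ) • (P ^ 2 * gamma P P) := by
        rw [MvPolynomial.smul_eq_C_mul, map_ofNat]
      rw [gamma_sq_sq, h4, map_smul, smul_eq_mul, ← pow_mul] at h2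
      linarith
    -- Cauchy–Schwarz and the induction hypothesis for each partial derivative
    have h2 : Ex (P ^ 2 * gamma P P) ≤ M * √C * Ex (gamma P P) := by
      rw [gamma, Finset.mul_sum, map_sum, map_sum, Finset.mul_sum]
      refine Finset.sum_le_sum fun i _ => ?_
      rw [← sq]
      refine (Ex_sq_mul_sq_le P (pderiv i P)).trans ?_
      rw [mul_assoc]
      refine mul_le_mul_of_nonneg_left ?_ hM0
      refine (Real.sqrt_le_sqrt (ih _ (totalDegree_pderiv_le i hP))).trans ?_
      rw [Real.sqrt_mul hC, Real.sqrt_sq (Ex_sq_nonneg _)]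
    have h3 : Ex (gamma P P) ≤ (d + 1) * Ex (P ^ 2) := by
      exact_mod_cast Ex_gamma_self_le hP
    have h4 : M * √C * Ex (gamma P P) ≤ M * √C * ((d + 1) * Ex (P ^ 2)) :=
      mul_le_mul_of_nonneg_left h3 (by positivity)
    have h5 : √C ^ 2 = C := Real.sq_sqrt hC
    -- Young's inequality absorbs half of `M ^ 2 = Ex (P ^ 4)` into the left-hand side
    have h6 : 4 * (M * √C * ((d + 1) * Ex (P ^ 2))) ≤
        M ^ 2 / 2 + 8 * C * (d + 1) ^ 2 * Ex (P ^ 2) ^ 2 := by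
      have h7 : (4 * √C * ((d + 1) * Ex (P ^ 2))) ^ 2 = 16 * C * (d + 1) ^ 2 * Ex (P ^ 2) ^ 2 := by
        rw [mul_pow, mul_pow, h5]; ring
      have h8 := sq_nonneg (M - 4 * √C * ((d + 1) * Ex (P ^ 2)))
      rw [sub_sq, h7] at h8
      linarith
    nlinarith

/-! ### The carré du champ on a fixed chaos -/

lemma gamma_self_eq (P : Poly) : gamma P P = P * numOp P - (1 / 2 : ℝ) • numOp (P ^ 2) := by
  have h : ∀ Q : Poly, (1 / 2 : ℝ) • (2 * Q) = Q := fun Q => by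
    rw [two_mul, ← two_smul ℝ, smul_smul]; norm_num
  rw [sq, numOp_mul, ← two_mul, ← mul_sub, h]
  abel

/-- The Hermite expansion of `Γ(P, P)` in terms of that of `P²`, for `P` in a fixed chaos. -/
lemma exists_gamma_self_decomp {q : ℕ} {P : Poly} (hP : P ∈ eig q) :
    ∃ c : ℕ → Poly, (∀ m, c m ∈ eig m) ∧
      P ^ 2 = ∑ m ∈ Finset.range (2 * q + 1), (1 : ℝ) • c m ∧
      gamma P P = ∑ m ∈ Finset.range (2 * q + 1), ((q : ℝ) - m / 2) • c m := by
  have hd : (P ^ 2).totalDegree ≤ 2 * q :=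
    (MvPolynomial.totalDegree_pow P 2).trans
      (Nat.mul_le_mul_left 2 (totalDegree_le_of_mem_eig hP))
  obtain ⟨c, hc, hP2⟩ := exists_eig_decomp hd
  have hP2' : P ^ 2 = ∑ m ∈ Finset.range (2 * q + 1), (1 : ℝ) • c m := by simpa using hP2
  refine ⟨c, hc, hP2', ?_⟩
  rw [gamma_self_eq, numOp_of_mem_eig hP, mul_smul_comm, ← sq, hP2', numOp_sum_smul hc,
    Finset.smul_sum, Finset.smul_sum, ← Finset.sum_sub_distrib]
  refine Finset.sum_congr rfl fun m _ => ?_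
  rw [smul_smul, smul_smul, ← sub_smul]
  congr 1
  ring

lemma Ex_gamma_self {q : ℕ} {P : Poly} (hP : P ∈ eig q) : Ex (gamma P P) = q * Ex (P ^ 2) := by
  rw [← Ex_numOp_mul, numOp_of_mem_eig hP, smul_mul_assoc, map_smul, smul_eq_mul, sq]

/-- The spectral inequality behind the fourth moment theorem: all eigenvalues occurring in
`P²` are at most `2q`. -/
lemma Ex_gamma_self_sq_le {q : ℕ} {P : Poly} (hP : P ∈ eig q) :
    Ex (gamma P P ^ 2) ≤ (q : ℝ) ^ 2 / 3 * Ex (P ^ 4) := by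
  obtain ⟨c, hc, h2, hg⟩ := exists_gamma_self_decomp hP
  -- by the Leibniz rule `Γ(P, P³) = 3 P² Γ(P, P)`
  have e1 : Ex (P ^ 2 * gamma P P) = (q : ℝ) / 3 * Ex (P ^ 4) := by
    have h3 : Ex (numOp P * P ^ 3) = 3 * Ex (P ^ 2 * gamma P P) := by
      have : (3 * P ^ 2 * gamma P P : Poly) = (3 : ℝ) • (P ^ 2 * gamma P P) := by
        rw [MvPolynomial.smul_eq_C_mul, map_ofNat, mul_assoc]
      rw [Ex_numOp_mul, gamma_comm, gamma_cube_left, this, map_smul, smul_eq_mul]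
    rw [numOp_of_mem_eig hP, smul_mul_assoc, map_smul, smul_eq_mul, ← pow_succ'] at h3
    linarith
  have e2 : Ex (P ^ 2 * gamma P P) =
      ∑ m ∈ Finset.range (2 * q + 1), 1 * ((q : ℝ) - m / 2) * Ex (c m ^ 2) := by
    rw [h2, hg, Ex_sum_mul_sum hc]
  have e3 : Ex (gamma P P ^ 2) = ∑ m ∈ Finset.range (2 * q + 1),
      ((q : ℝ) - m / 2) * ((q : ℝ) - m / 2) * Ex (c m ^ 2) := by
    rw [sq, hg, Ex_sum_mul_sum hc]
  -- termwise: `0 ≤ q - m / 2 ≤ q` for `m ≤ 2 q`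
  have e4 : Ex (gamma P P ^ 2) ≤ q * Ex (P ^ 2 * gamma P P) := by
    rw [e2, e3, Finset.mul_sum]
    refine Finset.sum_le_sum fun m hm => ?_
    have hm : (m : ℝ) ≤ 2 * q := by exact_mod_cast Nat.lt_succ_iff.1 (Finset.mem_range.1 hm)
    have : 0 ≤ ((q : ℝ) - m / 2) * (m / 2) * Ex (c m ^ 2) :=
      mul_nonneg (mul_nonneg (by linarith) (by positivity)) (Ex_sq_nonneg _)
    nlinarith
  rw [e1] at e4
  linarith

lemma Ex_numOp_gamma_self_sq_le {q : ℕ} {P : Poly} (hP : P ∈ eig q) :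
    Ex (numOp (gamma P P) ^ 2) ≤ (2 * q : ℝ) ^ 2 * Ex (gamma P P ^ 2) := by
  obtain ⟨c, hc, -, hg⟩ := exists_gamma_self_decomp hP
  rw [sq (numOp _), sq (gamma P P), hg, numOp_sum_smul hc, Ex_sum_mul_sum hc, Ex_sum_mul_sum hc,
    Finset.mul_sum]
  refine Finset.sum_le_sum fun m hm => ?_
  have hm : (m : ℝ) ≤ 2 * q := by exact_mod_cast Nat.lt_succ_iff.1 (Finset.mem_range.1 hm)
  have h2 : (m : ℝ) ^ 2 ≤ (2 * q) ^ 2 := by gcongr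
  have : 0 ≤ ((q : ℝ) - m / 2) ^ 2 * Ex (c m ^ 2) := mul_nonneg (sq_nonneg _) (Ex_sq_nonneg _)
  nlinarith

/-- The fourth moment bound: `Γ(P, P)` concentrates around `q v` as soon as the second and
fourth moments of `P` are close to those of a centred Gaussian variable of variance `v`. -/
lemma Ex_gamma_self_sub_sq_le {q : ℕ} {P : Poly} (hP : P ∈ eig q) (v : ℝ) :
    Ex ((gamma P P - MvPolynomial.C (q * v)) ^ 2) ≤
      (q : ℝ) ^ 2 * (Ex (P ^ 4) / 3 - 2 * v * Ex (P ^ 2) + v ^ 2) := by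
  have h1 : (gamma P P - MvPolynomial.C (q * v)) ^ 2 =
      gamma P P ^ 2 - (2 * (q * v)) • gamma P P + MvPolynomial.C ((q * v) ^ 2) := by
    simp only [MvPolynomial.smul_eq_C_mul, map_mul, map_pow, map_ofNat]; ring
  rw [h1, map_add, map_sub, map_smul, Ex_C, Ex_gamma_self hP, smul_eq_mul]
  nlinarith [Ex_gamma_self_sq_le hP]

lemma ev_gamma_sq_le (P Q : Poly) (ω : ℕ → ℝ) :
    ev (gamma P Q ^ 2) ω ≤ ev (gamma P P * gamma Q Q) ω := by
  rw [gamma_eq_sum (P := P) (S := P.vars ∪ Q.vars) Finset.subset_union_left,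
    gamma_eq_sum (P := P) (S := P.vars ∪ Q.vars) Finset.subset_union_left,
    gamma_eq_sum (P := Q) (S := P.vars ∪ Q.vars) Finset.subset_union_right]
  simp only [ev_pow, ev_mul, ev_sum, ← sq]
  exact Finset.sum_mul_sq_le_sq_mul_sq _ _ _

/-- For `P` in a fixed chaos, `Γ(P, R)` is controlled in `L²` by `R` and its image under the number
operator. After the Cauchy–Schwarz inequality `Γ(P, R)² ≤ Γ(P, P) Γ(R, R)`, the operator is moved
onto `Γ(P, P)`, where it is bounded. -/
lemma exists_Ex_gamma_sq_le (q : ℕ) :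
    ∃ K : ℝ, 0 ≤ K ∧ ∀ P ∈ eig q, ∀ R : Poly,
      Ex (gamma P R ^ 2) ≤ K * Ex (P ^ 2) * (√(Ex (R ^ 4)) + √(Ex (numOp R ^ 4))) := by
  obtain ⟨C, hC, hyp⟩ := exists_Ex_pow_four_le q
  refine ⟨q * √C * (1 + q), by positivity, fun P hP R => ?_⟩
  set w := gamma P P with hw
  set r := √(Ex (R ^ 4)) with hr
  set n := √(Ex (numOp R ^ 4)) with hn
  have hr0 : 0 ≤ r := Real.sqrt_nonneg _
  have hn0 : 0 ≤ n := Real.sqrt_nonneg _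
  have hA : √(Ex (w ^ 2)) ≤ q * √C * Ex (P ^ 2) := by
    refine Real.sqrt_le_iff.2 ⟨mul_nonneg (by positivity) (Ex_sq_nonneg P), ?_⟩
    rw [mul_pow, mul_pow, Real.sq_sqrt hC]
    have h1 := Ex_gamma_self_sq_le hP
    have h2 := hyp P (totalDegree_le_of_mem_eig hP)
    have h3 : (q : ℝ) ^ 2 * Ex (P ^ 4) ≤ (q : ℝ) ^ 2 * (C * Ex (P ^ 2) ^ 2) := by gcongr
    have h4 : 0 ≤ (q : ℝ) ^ 2 * Ex (P ^ 4) := mul_nonneg (by positivity) (Ex_pow_four_nonneg P)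
    nlinarith
  have hB : √(Ex (numOp w ^ 2)) ≤ 2 * q * √(Ex (w ^ 2)) := by
    refine (Real.sqrt_le_sqrt (Ex_numOp_gamma_self_sq_le hP)).trans ?_
    rw [Real.sqrt_mul (by positivity), Real.sqrt_sq (by positivity)]
  have h1 : Ex (gamma P R ^ 2) ≤ Ex (w * (R * numOp R)) - 1 / 2 * Ex (numOp w * R ^ 2) := by
    refine (Ex_le (ev_gamma_sq_le P R)).trans (le_of_eq ?_)
    rw [gamma_self_eq R, mul_sub, mul_smul_comm, map_sub, map_smul, smul_eq_mul,
      Ex_numOp_mul_comm]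
  have h2 : Ex (w * (R * numOp R)) ≤ √(Ex (w ^ 2)) * ((r + n) / 2) := by
    refine ((le_abs_self _).trans (abs_Ex_mul_le _ _)).trans ?_
    refine mul_le_mul_of_nonneg_left ?_ (Real.sqrt_nonneg _)
    refine Real.sqrt_le_iff.2 ⟨by positivity, ?_⟩
    rw [mul_pow]
    refine (Ex_sq_mul_sq_le R (numOp R)).trans ?_
    nlinarith [sq_nonneg (r - n)]
  have h3 : -Ex (numOp w * R ^ 2) ≤ 2 * q * √(Ex (w ^ 2)) * r := by
    refine ((neg_le_abs _).trans (abs_Ex_mul_le _ _)).trans ?_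
    rw [← pow_mul]
    exact mul_le_mul_of_nonneg_right hB hr0
  have h4 : Ex (gamma P R ^ 2) ≤ √(Ex (w ^ 2)) * ((1 + q) * (r + n)) := by
    have : 0 ≤ √(Ex (w ^ 2)) * (r + n) := by positivity
    have : 0 ≤ √(Ex (w ^ 2)) * q * n := by positivity
    nlinarith
  refine h4.trans ((mul_le_mul_of_nonneg_right hA (by positivity)).trans (le_of_eq ?_))
  ring

/-! ### Chaos decomposition and the Ornstein–Uhlenbeck generator -/

/-- Polynomials as elements of `L^p`, for finite `p`. -/
noncomputable def evLp (p : ℝ≥0∞) (hp : p ≠ ∞) : Poly →ₗ[ℝ] Lp ℝ p wiener where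
  toFun P := (memLp_ev P hp).toLp
  map_add' P Q := by
    rw [← MemLp.toLp_add]
    exact MemLp.toLp_congr _ _ (ae_of_all _ fun ω => ev_add P Q ω)
  map_smul' c P := by
    rw [RingHom.id_apply, ← MemLp.toLp_const_smul]
    exact MemLp.toLp_congr _ _ (ae_of_all _ fun ω => ev_smul c P ω)

/-- Polynomials as elements of `L²`. -/
noncomputable abbrev toL2 : Poly →ₗ[ℝ] L2 := evLp 2 (by simp)

instance fact_one_le_four : Fact ((1 : ℝ≥0∞) ≤ 4) := ⟨by norm_num⟩

/-- Polynomials as elements of `L⁴`. -/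
noncomputable abbrev toL4 : Poly →ₗ[ℝ] Lp ℝ 4 wiener := evLp 4 (by simp)

lemma coeFn_evLp (p : ℝ≥0∞) (hp : p ≠ ∞) (P : Poly) : evLp p hp P =ᵐ[wiener] ev P :=
  (memLp_ev P hp).coeFn_toLp

open scoped InnerProductSpace in
lemma inner_toL2 (P Q : Poly) : ⟪toL2 P, toL2 Q⟫_ℝ = Ex (P * Q) := by
  rw [L2.inner_def, Ex_def]
  refine integral_congr_ae ?_
  filter_upwards [coeFn_evLp 2 (by simp) P, coeFn_evLp 2 (by simp) Q] with ω h1 h2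
  rw [h1, h2, ev_mul]
  simp [mul_comm]

lemma norm_toL2_sq (P : Poly) : ‖toL2 P‖ ^ 2 = Ex (P ^ 2) := by
  rw [← real_inner_self_eq_norm_sq, inner_toL2, sq]

lemma norm_toL4_pow_four (P : Poly) : ‖toL4 P‖ ^ 4 = Ex (P ^ 4) := by
  have h : ‖toL4 P‖ = (∫ ω, ‖ev P ω‖ ^ (4 : ℝ) ∂wiener) ^ (4 : ℝ)⁻¹ := by
    change ‖(memLp_ev P (p := 4) (by simp)).toLp‖ = _
    rw [Lp.norm_toLp, (memLp_ev P (by simp)).eLpNorm_eq_integral_rpow_norm (by simp) (by simp),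
      ENNReal.toReal_ofReal (by positivity)]
    simp
  have h0 : 0 ≤ ∫ ω, ‖ev P ω‖ ^ (4 : ℝ) ∂wiener := integral_nonneg fun ω => by positivity
  rw [h, ← Real.rpow_natCast, ← Real.rpow_mul h0]
  norm_num
  rw [Ex_def]
  refine integral_congr_ae (ae_of_all _ fun ω => ?_)
  simp only [ev_pow]
  exact (by decide : Even 4).pow_abs _

lemma sqrt_Ex_pow_four (P : Poly) : √(Ex (P ^ 4)) = ‖toL4 P‖ ^ 2 := by
  rw [← norm_toL4_pow_four, show ‖toL4 P‖ ^ 4 = (‖toL4 P‖ ^ 2) ^ 2 by ring,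
    Real.sqrt_sq (by positivity)]

lemma hermiteProd_eq (k : ℕ →₀ ℕ) : hermiteProd k = ev (herm k) := by
  ext ω
  rw [hermiteProd, herm, ev, Finsupp.prod, Finsupp.prod, map_prod]
  refine Finset.prod_congr rfl fun i _ => ?_
  have := Polynomial.aeval_algHom_apply (MvPolynomial.eval ω).toIntAlgHom
    (MvPolynomial.X i : Poly) (Polynomial.hermite (k i))
  simpa [hermVar] using this

lemma chaos_eq (q : ℕ) : chaos q = ((eig q).map toL2).topologicalClosure := by
  rw [chaos, eig, Submodule.map_span]
  congr 2
  ext F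
  constructor
  · rintro ⟨k, hk, hF⟩
    refine ⟨herm k, ⟨k, hk, rfl⟩, Lp.ext ?_⟩
    filter_upwards [hF, coeFn_evLp 2 (by simp) (herm k)] with ω h1 h2
    rw [h1, h2, hermiteProd_eq]
  · rintro ⟨P, ⟨k, hk, rfl⟩, rfl⟩
    refine ⟨k, hk, ?_⟩
    rw [hermiteProd_eq]
    exact coeFn_evLp _ _ _

lemma toL2_mem_chaos {q : ℕ} {P : Poly} (h : P ∈ eig q) : toL2 P ∈ chaos q := by
  rw [chaos_eq]
  exact Submodule.le_topologicalClosure _ (Submodule.mem_map_of_mem h)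

lemma exists_seq_of_mem_closure {U : Submodule ℝ Poly} {F : L2}
    (h : F ∈ (U.map toL2).topologicalClosure) :
    ∃ S : ℕ → Poly, (∀ j, S j ∈ U) ∧ Tendsto (fun j => toL2 (S j)) atTop (𝓝 F) := by
  obtain ⟨x, hx, hlim⟩ := mem_closure_iff_seq_limit.1 h
  choose S hS hSx using hx
  exact ⟨S, hS, by simpa only [hSx] using hlim⟩

lemma chaos_isOrtho {m n : ℕ} (h : m ≠ n) : chaos m ⟂ chaos n := by
  rw [Submodule.isOrtho_iff_inner_eq]
  intro F hF G hG
  rw [chaos_eq] at hF hG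
  obtain ⟨S, hS, hSF⟩ := exists_seq_of_mem_closure hF
  obtain ⟨T, hT, hTG⟩ := exists_seq_of_mem_closure hG
  refine tendsto_nhds_unique (hSF.inner hTG) ?_
  simp only [inner_toL2, Ex_mul_eq_zero_of_mem_eig h (hS _) (hT _)]
  exact tendsto_const_nhds

lemma proj_of_mem {m : ℕ} {F : L2} (h : F ∈ chaos m) : proj m F = F :=
  Submodule.starProjection_eq_self_iff.2 h

lemma proj_of_mem_ne {m n : ℕ} (hmn : m ≠ n) {F : L2} (h : F ∈ chaos m) : proj n F = 0 :=
  (Submodule.starProjection_apply_eq_zero_iff _).2 (chaos_isOrtho hmn h)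

lemma proj_mem (m : ℕ) (F : L2) : proj m F ∈ chaos m := Submodule.starProjection_apply_mem _ _

lemma proj_toL2_numOp (n : ℕ) (P : Poly) :
    proj n (toL2 (numOp P)) = (n : ℝ) • proj n (toL2 P) := by
  obtain ⟨c, hc, hP⟩ := exists_eig_decomp (le_refl P.totalDegree)
  rw [hP, numOp_sum, map_sum, map_sum, map_sum, map_sum, Finset.smul_sum]
  refine Finset.sum_congr rfl fun m _ => ?_
  rw [numOp_of_mem_eig (hc m), map_smul, map_smul]
  by_cases h : m = n
  · rw [h]
  · rw [proj_of_mem_ne h (toL2_mem_chaos (hc m)), smul_zero, smul_zero]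

open scoped InnerProductSpace in
lemma norm_sum_proj_le (s : Finset ℕ) (F : L2) : ‖∑ m ∈ s, proj m F‖ ≤ ‖F‖ := by
  set T := ∑ m ∈ s, proj m F with hT
  have h1 : ⟪T, T⟫_ℝ = ⟪T, F⟫_ℝ := by
    conv_lhs => rw [hT, sum_inner]
    rw [hT, sum_inner]
    refine Finset.sum_congr rfl fun m hm => ?_
    rw [inner_sum, Finset.sum_eq_single m]
    · have := Submodule.starProjection_inner_eq_zero (K := chaos m) F (proj m F) (proj_mem m F)
      rw [inner_sub_left, sub_eq_zero] at this
      rw [real_inner_comm F]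
      exact this.symm
    · intro n _ hn
      exact (Submodule.isOrtho_iff_inner_eq.1 (chaos_isOrtho hn.symm)) _ (proj_mem m F) _
        (proj_mem n F)
    · exact fun h => absurd hm h
  have h2 : ‖T‖ * ‖T‖ ≤ ‖T‖ * ‖F‖ := by
    rw [← real_inner_self_eq_norm_mul_norm, h1]
    exact real_inner_le_norm _ _
  by_cases h0 : ‖T‖ = 0
  · rw [h0]; exact norm_nonneg _
  · exact le_of_mul_le_mul_left h2 (lt_of_le_of_ne (norm_nonneg _) (Ne.symm h0))

/-- The chaos expansion of a limit of polynomials: the partial sums are contractions which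
eventually fix a given polynomial. -/
lemma hasSum_proj {S : ℕ → Poly} {Z : L2} (hS : Tendsto (fun j => toL2 (S j)) atTop (𝓝 Z)) :
    HasSum (fun m => proj m Z) Z := by
  rw [HasSum, SummationFilter.unconditional_filter, Metric.tendsto_atTop]
  intro ε hε
  obtain ⟨j, hj⟩ := (Metric.tendsto_atTop.1 hS (ε / 2) (by positivity))
  specialize hj j le_rfl
  set P := S j
  obtain ⟨c, hc, hP⟩ := exists_eig_decomp (le_refl P.totalDegree)
  refine ⟨Finset.range (P.totalDegree + 1), fun s hs => ?_⟩
  have hfix : ∑ m ∈ s, proj m (toL2 P) = toL2 P := by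
    have : ∀ m ∈ s, proj m (toL2 P) =
        ∑ n ∈ Finset.range (P.totalDegree + 1), if n = m then toL2 (c n) else 0 := by
      intro m _
      conv_lhs => rw [hP, map_sum, map_sum]
      refine Finset.sum_congr rfl fun n _ => ?_
      split_ifs with h
      · subst h; exact proj_of_mem (toL2_mem_chaos (hc n))
      · exact proj_of_mem_ne h (toL2_mem_chaos (hc n))
    rw [Finset.sum_congr rfl this, Finset.sum_comm]
    conv_rhs => rw [hP, map_sum]
    refine Finset.sum_congr rfl fun n hn => ?_
    rw [Finset.sum_ite_eq, if_pos (hs hn)]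
  have h1 := norm_sum_proj_le s (Z - toL2 P)
  have h2 : ∑ m ∈ s, proj m Z - Z = ∑ m ∈ s, proj m (Z - toL2 P) - (Z - toL2 P) := by
    simp only [map_sub, Finset.sum_sub_distrib, hfix]
    abel
  rw [dist_eq_norm] at hj ⊢
  rw [norm_sub_rev] at hj
  rw [h2]
  exact (norm_sub_le _ _).trans_lt (by linarith)

/-- The generator is closed on limits of polynomials. -/
lemma ou_eq_of_tendsto {S : ℕ → Poly} {F Z : L2}
    (hS : Tendsto (fun j => toL2 (S j)) atTop (𝓝 F))
    (hN : Tendsto (fun j => toL2 (-numOp (S j))) atTop (𝓝 Z)) : ou F = Z := by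
  have key : ∀ n : ℕ, -(n : ℝ) • proj n F = proj n Z := by
    intro n
    refine tendsto_nhds_unique ((((proj n).continuous.tendsto F).comp hS).const_smul _) ?_
    refine (((proj n).continuous.tendsto Z).comp hN).congr fun j => ?_
    simp only [Function.comp_apply, map_neg, proj_toL2_numOp, neg_smul]
  rw [ou]
  simp_rw [key]
  exact (hasSum_proj hN).tsum_eq

/-! ### Approximation by polynomials -/

lemma exists_norm_toL4_le (d : ℕ) :
    ∃ K : ℝ, 0 ≤ K ∧ ∀ P : Poly, P.totalDegree ≤ d → ‖toL4 P‖ ≤ K * ‖toL2 P‖ := by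
  obtain ⟨C, hC, h⟩ := exists_Ex_pow_four_le d
  refine ⟨√√C, Real.sqrt_nonneg _, fun P hP => ?_⟩
  have h1 : √√C ^ 4 = C := by
    rw [show √√C ^ 4 = (√√C ^ 2) ^ 2 by ring, Real.sq_sqrt (Real.sqrt_nonneg _), Real.sq_sqrt hC]
  refine le_of_pow_le_pow_left₀ (n := 4) (by norm_num) (by positivity) ?_
  rw [mul_pow, h1, norm_toL4_pow_four]
  refine (h P hP).trans (le_of_eq ?_)
  rw [← norm_toL2_sq]; ring

/-- For polynomials of bounded degree, convergence in `L²` implies convergence in `L⁴`. -/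
lemma exists_tendsto_toL4 {d : ℕ} {S : ℕ → Poly} (hd : ∀ j, (S j).totalDegree ≤ d) {F : L2}
    (hS : Tendsto (fun j => toL2 (S j)) atTop (𝓝 F)) :
    ∃ F4 : Lp ℝ 4 wiener, F4 =ᵐ[wiener] F ∧ Tendsto (fun j => toL4 (S j)) atTop (𝓝 F4) := by
  obtain ⟨K, hK, hyp⟩ := exists_norm_toL4_le d
  have hc : CauchySeq fun j => toL4 (S j) := by
    have h1 := cauchySeq_iff_tendsto_dist_atTop_0.1 hS.cauchySeq
    rw [cauchySeq_iff_tendsto_dist_atTop_0]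
    refine squeeze_zero (fun _ => dist_nonneg) (fun n => ?_) (by simpa using h1.const_mul K)
    rw [dist_eq_norm, dist_eq_norm, ← map_sub, ← map_sub]
    exact hyp _ ((MvPolynomial.totalDegree_sub _ _).trans (max_le (hd _) (hd _)))
  obtain ⟨F4, hF4⟩ := cauchySeq_tendsto_of_complete hc
  refine ⟨F4, ?_, hF4⟩
  have m4 := tendstoInMeasure_of_tendsto_Lp hF4
  have m2 := tendstoInMeasure_of_tendsto_Lp hS
  refine tendstoInMeasure_ae_unique (m4.congr_left fun j => ?_) m2
  exact (coeFn_evLp 4 (by simp) _).trans (coeFn_evLp 2 (by simp) _).symm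

lemma numOp_bounds {d : ℕ} {P : Poly} (h : P.totalDegree ≤ d) :
    (numOp P).totalDegree ≤ d ∧ ‖toL2 (numOp P)‖ ≤ d * ‖toL2 P‖ := by
  obtain ⟨c, hc, hP⟩ := exists_eig_decomp h
  have hP1 : P = ∑ m ∈ Finset.range (d + 1), (1 : ℝ) • c m := by simpa using hP
  have hNP : numOp P = ∑ m ∈ Finset.range (d + 1), (m * 1 : ℝ) • c m := by
    conv_lhs => rw [hP1]
    rw [numOp_sum_smul hc]
  constructor
  · rw [hNP]
    refine MvPolynomial.totalDegree_finsetSum_le fun m hm => ?_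
    exact (MvPolynomial.totalDegree_smul_le _ _).trans
      ((totalDegree_le_of_mem_eig (hc m)).trans (Nat.lt_succ_iff.1 (Finset.mem_range.1 hm)))
  · refine le_of_pow_le_pow_left₀ (n := 2) (by norm_num) (by positivity) ?_
    rw [mul_pow, norm_toL2_sq, norm_toL2_sq, sq, sq P, hNP]
    rw [hP1, Ex_sum_mul_sum hc, Ex_sum_mul_sum hc, Finset.mul_sum]
    refine Finset.sum_le_sum fun m hm => ?_
    have hm : (m : ℝ) ≤ d := by exact_mod_cast Nat.lt_succ_iff.1 (Finset.mem_range.1 hm)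
    have h2 : (m : ℝ) ^ 2 ≤ d ^ 2 := by gcongr
    nlinarith [Ex_sq_nonneg (c m)]

lemma chaosLE_le (d : ℕ) :
    chaosLE d ≤ ((MvPolynomial.restrictTotalDegree ℕ ℝ d).map toL2).topologicalClosure := by
  refine iSup₂_le fun m hm => ?_
  rw [chaos_eq]
  refine Submodule.topologicalClosure_mono (Submodule.map_mono fun P hP => ?_)
  exact (MvPolynomial.mem_restrictTotalDegree _ _ _).2
    ((totalDegree_le_of_mem_eig hP).trans (Nat.lt_succ_iff.1 (Finset.mem_range.1 hm)))

/-- `PolyApprox S F F₄ L₄`: the polynomials `S j` tend to `F` and `-N (S j)` tend to `ou F`, both in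
`L⁴`; here `F₄` and `L₄` are `F` and `ou F` as elements of `L⁴`. -/
structure PolyApprox (S : ℕ → Poly) (F : L2) (F4 L4 : Lp ℝ 4 wiener) : Prop where
  coe_eq : F4 =ᵐ[wiener] F
  coe_ou_eq : L4 =ᵐ[wiener] ou F
  tendsto : Tendsto (fun j => toL4 (S j)) atTop (𝓝 F4)
  tendsto_ou : Tendsto (fun j => toL4 (-numOp (S j))) atTop (𝓝 L4)

lemma exists_polyApprox_of_tendsto {d : ℕ} {S : ℕ → Poly} (hd : ∀ j, (S j).totalDegree ≤ d)
    {F : L2} (hS : Tendsto (fun j => toL2 (S j)) atTop (𝓝 F)) :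
    ∃ F4 L4, PolyApprox S F F4 L4 := by
  have hc : CauchySeq fun j => toL2 (-numOp (S j)) := by
    have h1 := cauchySeq_iff_tendsto_dist_atTop_0.1 hS.cauchySeq
    rw [cauchySeq_iff_tendsto_dist_atTop_0]
    refine squeeze_zero (fun _ => dist_nonneg) (fun n => ?_) (by simpa using h1.const_mul (d : ℝ))
    rw [map_neg, map_neg, dist_neg_neg, dist_eq_norm, dist_eq_norm, ← map_sub, ← map_sub,
      ← numOp_sub]
    exact (numOp_bounds ((MvPolynomial.totalDegree_sub _ _).trans (max_le (hd _) (hd _)))).2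
  obtain ⟨Z, hZ⟩ := cauchySeq_tendsto_of_complete hc
  obtain ⟨F4, hF4, hF4'⟩ := exists_tendsto_toL4 hd hS
  obtain ⟨L4, hL4, hL4'⟩ := exists_tendsto_toL4 (d := d)
    (fun j => by rw [MvPolynomial.totalDegree_neg]; exact (numOp_bounds (hd j)).1) hZ
  exact ⟨F4, L4, hF4, by rwa [ou_eq_of_tendsto hS hZ], hF4', hL4'⟩

lemma tendsto_toL4_iff {S : ℕ → Poly} {F4 : Lp ℝ 4 wiener} {F : (ℕ → ℝ) → ℝ}
    (h : F4 =ᵐ[wiener] F) :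
    Tendsto (fun j => toL4 (S j)) atTop (𝓝 F4) ↔
      Tendsto (fun j => eLpNorm (fun ω => ev (S j) ω - F ω) 4 wiener) atTop (𝓝 0) := by
  rw [Lp.tendsto_Lp_iff_tendsto_eLpNorm']
  refine tendsto_congr fun j => eLpNorm_congr_ae ?_
  filter_upwards [h, coeFn_evLp 4 (by simp) (S j)] with ω h1 h2
  simp [h1, h2]

lemma exists_poly_of_mem_chaosLE {d : ℕ} {F : L2} (hF : F ∈ chaosLE d) {ε : ℝ≥0∞} (hε : 0 < ε) :
    ∃ R : Poly, eLpNorm (fun ω => ev R ω - F ω) 4 wiener ≤ ε ∧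
      eLpNorm (fun ω => ev (-numOp R) ω - ou F ω) 4 wiener ≤ ε := by
  obtain ⟨S, hS, hSF⟩ := exists_seq_of_mem_closure (chaosLE_le d hF)
  obtain ⟨F4, L4, h⟩ := exists_polyApprox_of_tendsto
    (fun j => (MvPolynomial.mem_restrictTotalDegree _ _ _).1 (hS j)) hSF
  have h1 := (tendsto_toL4_iff h.coe_eq).1 h.tendsto
  have h2 := (tendsto_toL4_iff h.coe_ou_eq).1 h.tendsto_ou
  obtain ⟨j, hj1, hj2⟩ := ((h1.eventually (Iic_mem_nhds hε)).and
    (h2.eventually (Iic_mem_nhds hε))).exists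
  exact ⟨S j, hj1, hj2⟩

lemma exists_toL4_limit {S : ℕ → Poly} {F : L2}
    (h : Tendsto (fun j => eLpNorm (fun ω => ev (S j) ω - F ω) 4 wiener) atTop (𝓝 0)) :
    ∃ F4 : Lp ℝ 4 wiener, F4 =ᵐ[wiener] F ∧ Tendsto (fun j => toL4 (S j)) atTop (𝓝 F4) := by
  obtain ⟨j, hj⟩ := (h.eventually (Iio_mem_nhds (zero_lt_one' ℝ≥0∞))).exists
  have hd : MemLp (fun ω => ev (S j) ω - F ω) 4 wiener :=
    ⟨(measurable_ev _).aestronglyMeasurable.sub (Lp.aestronglyMeasurable F),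
      lt_of_lt_of_le hj le_top⟩
  have hF : MemLp F 4 wiener := by
    have := (memLp_ev (S j) (p := 4) (by simp)).sub hd
    refine this.ae_eq (ae_of_all _ fun ω => ?_)
    simp
  exact ⟨hF.toLp, hF.coeFn_toLp, (tendsto_toL4_iff hF.coeFn_toLp).2 h⟩

lemma tendsto_eLpNorm_sub_of_le {f g : ℕ → (ℕ → ℝ) → ℝ} {F : (ℕ → ℝ) → ℝ}
    (hf : ∀ m, AEStronglyMeasurable (f m) wiener) (hg : ∀ m, AEStronglyMeasurable (g m) wiener)
    (hF : AEStronglyMeasurable F wiener)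
    (h1 : ∀ m : ℕ, eLpNorm (fun ω => f m ω - g m ω) 4 wiener ≤ ((m : ℝ≥0∞) + 1)⁻¹)
    (h2 : Tendsto (fun m => eLpNorm (fun ω => g m ω - F ω) 4 wiener) atTop (𝓝 0)) :
    Tendsto (fun m => eLpNorm (fun ω => f m ω - F ω) 4 wiener) atTop (𝓝 0) := by
  have h3 : Tendsto (fun m : ℕ => ((m : ℝ≥0∞) + 1)⁻¹) atTop (𝓝 0) := by
    have := (tendsto_add_atTop_iff_nat 1).2 ENNReal.tendsto_inv_nat_nhds_zero
    simpa using this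
  refine tendsto_of_tendsto_of_tendsto_of_le_of_le tendsto_const_nhds
    (by simpa using h3.add h2) (fun _ => zero_le) fun m => ?_
  refine le_trans ?_ (add_le_add_left (h1 m) _)
  refine le_trans (le_of_eq ?_) (eLpNorm_add_le ((hf m).sub (hg m)) ((hg m).sub hF) (by norm_num))
  congr 1
  ext ω
  simp

lemma exists_polyApprox_of_mem_DInf {Y : L2} (hY : Y ∈ DInf) :
    ∃ S F4 L4, PolyApprox S Y F4 L4 := by
  obtain ⟨P, hP, hlim⟩ := hY
  have h0 := hlim 0 4 (by norm_num) (by simp)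
  have h1 := hlim 1 4 (by norm_num) (by simp)
  simp only [Function.iterate_zero, id, Function.iterate_one] at h0 h1
  choose d hd using hP
  have hpos : ∀ m : ℕ, (0 : ℝ≥0∞) < ((m : ℝ≥0∞) + 1)⁻¹ := fun m => by simp
  choose S hS0 hS1 using fun m => exists_poly_of_mem_chaosLE (hd m) (hpos m)
  obtain ⟨F4, hF4, hF4'⟩ := exists_toL4_limit (S := S) (F := Y)
    (tendsto_eLpNorm_sub_of_le (fun m => (measurable_ev _).aestronglyMeasurable)
      (fun m => Lp.aestronglyMeasurable _) (Lp.aestronglyMeasurable _) hS0 h0)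
  obtain ⟨L4, hL4, hL4'⟩ := exists_toL4_limit (S := fun m => -numOp (S m)) (F := ou Y)
    (tendsto_eLpNorm_sub_of_le (fun m => (measurable_ev _).aestronglyMeasurable)
      (fun m => Lp.aestronglyMeasurable _) (Lp.aestronglyMeasurable _) hS1 h1)
  exact ⟨S, F4, L4, hF4, hL4, hF4', hL4'⟩

instance holderTriple_four_four_two : ENNReal.HolderTriple 4 4 2 := ⟨by
  have : (4 : ℝ≥0∞) = 2 * 2 := by norm_num
  rw [this, ENNReal.mul_inv (by simp) (by simp), ← add_mul, ENNReal.inv_two_add_inv_two, one_mul]⟩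

/-- Multiplication as a continuous bilinear map from `L⁴` to `L²`. -/
noncomputable def mul42 : Lp ℝ 4 wiener →L[ℝ] Lp ℝ 4 wiener →L[ℝ] L2 :=
  (ContinuousLinearMap.mul ℝ ℝ).holderL wiener 4 4 2

lemma coeFn_mul42 (F G : Lp ℝ 4 wiener) : mul42 F G =ᵐ[wiener] fun ω => F ω * G ω :=
  (ContinuousLinearMap.mul ℝ ℝ).coeFn_holder (r := 2) F G

lemma toL2_mul (P Q : Poly) : toL2 (P * Q) = mul42 (toL4 P) (toL4 Q) := by
  refine Lp.ext ?_
  filter_upwards [coeFn_mul42 (toL4 P) (toL4 Q), coeFn_evLp 2 (by simp) (P * Q),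
    coeFn_evLp 4 (by simp) P, coeFn_evLp 4 (by simp) Q] with ω h1 h2 h3 h4
  rw [h1, h2, h3, h4, ev_mul]

lemma tendsto_toL2_mul {S T : ℕ → Poly} {F G : Lp ℝ 4 wiener}
    (hS : Tendsto (fun j => toL4 (S j)) atTop (𝓝 F))
    (hT : Tendsto (fun j => toL4 (T j)) atTop (𝓝 G)) :
    Tendsto (fun j => toL2 (S j * T j)) atTop (𝓝 (mul42 F G)) := by
  have hc : Continuous fun p : Lp ℝ 4 wiener × Lp ℝ 4 wiener => mul42 p.1 p.2 :=
    mul42.continuous₂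
  have h : Tendsto (fun j => (toL4 (S j), toL4 (T j))) atTop (𝓝 (F, G)) := hS.prodMk_nhds hT
  refine ((hc.tendsto (F, G)).comp h).congr fun j => ?_
  exact (toL2_mul _ _).symm

lemma exists_norm_gamma_le (q : ℕ) :
    ∃ K : ℝ, 0 ≤ K ∧ ∀ P ∈ eig q, ∀ R : Poly,
      ‖toL2 (gamma P R)‖ ≤ K * ‖toL2 P‖ * (‖toL4 R‖ + ‖toL4 (-numOp R)‖) := by
  obtain ⟨K, hK, h⟩ := exists_Ex_gamma_sq_le q
  refine ⟨√K, Real.sqrt_nonneg _, fun P hP R => ?_⟩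
  refine le_of_pow_le_pow_left₀ (n := 2) (by norm_num) (by positivity) ?_
  rw [norm_toL2_sq, mul_pow, mul_pow, Real.sq_sqrt hK, norm_toL2_sq, map_neg, norm_neg]
  refine (h P hP R).trans (mul_le_mul_of_nonneg_left ?_ (mul_nonneg hK (Ex_sq_nonneg _)))
  rw [sqrt_Ex_pow_four, sqrt_Ex_pow_four]
  nlinarith [mul_nonneg (norm_nonneg (toL4 R)) (norm_nonneg (toL4 (numOp R)))]

/-- The carré du champ of polynomial approximations converges in `L²` to the carré du champ
of the limits. In particular the series defining the generator of the product converges. -/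
lemma tendsto_gamma {q : ℕ} {X Y : L2} {P R : ℕ → Poly} {X4 LX4 Y4 LY4 : Lp ℝ 4 wiener}
    (hPq : ∀ j, P j ∈ eig q) (hPX : Tendsto (fun j => toL2 (P j)) atTop (𝓝 X))
    (hX : PolyApprox P X X4 LX4) (hY : PolyApprox R Y Y4 LY4) :
    ∃ G : L2, G =ᵐ[wiener] Gam X Y ∧ Tendsto (fun j => toL2 (gamma (P j) (R j))) atTop (𝓝 G) := by
  obtain ⟨K, hK, hyp⟩ := exists_norm_gamma_le q
  -- bilinearity and the bound on `Γ` give a Cauchy sequence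
  have hc : CauchySeq fun j => toL2 (gamma (P j) (R j)) := by
    have d1 := cauchySeq_iff_tendsto_dist_atTop_0.1 hPX.cauchySeq
    have d2 := cauchySeq_iff_tendsto_dist_atTop_0.1 hY.tendsto.cauchySeq
    have d3 := cauchySeq_iff_tendsto_dist_atTop_0.1 hY.tendsto_ou.cauchySeq
    rw [← prod_atTop_atTop_eq] at d1 d2 d3
    have n1 := (hPX.comp (tendsto_snd (f := (atTop : Filter ℕ)))).norm
    have n2 := (hY.tendsto.comp (tendsto_fst (g := (atTop : Filter ℕ)))).norm
    have n3 := (hY.tendsto_ou.comp (tendsto_fst (g := (atTop : Filter ℕ)))).norm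
    rw [cauchySeq_iff_tendsto_dist_atTop_0, ← prod_atTop_atTop_eq]
    have lim := ((d1.const_mul K).mul (n2.add n3)).add ((n1.const_mul K).mul (d2.add d3))
    simp only [mul_zero, zero_mul, add_zero] at lim
    refine squeeze_zero (fun _ => dist_nonneg) (fun n => ?_) lim
    have e : gamma (P n.1) (R n.1) - gamma (P n.2) (R n.2) =
        gamma (P n.1 - P n.2) (R n.1) + gamma (P n.2) (R n.1 - R n.2) := by
      rw [gamma_sub_left, gamma_sub_right]; abel
    rw [dist_eq_norm, ← map_sub, e, map_add]
    refine (norm_add_le _ _).trans (add_le_add ?_ ?_)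
    · have := hyp _ (Submodule.sub_mem _ (hPq n.1) (hPq n.2)) (R n.1)
      rwa [map_sub toL2, ← dist_eq_norm] at this
    · have := hyp _ (hPq n.2) (R n.1 - R n.2)
      rw [numOp_sub, neg_sub', map_sub toL4, map_sub toL4, ← dist_eq_norm, ← dist_eq_norm] at this
      exact this
  obtain ⟨G, hG⟩ := cauchySeq_tendsto_of_complete hc
  refine ⟨G, ?_, hG⟩
  have hprod : Tendsto (fun j => toL2 (P j * R j)) atTop (𝓝 (mul42 X4 Y4)) :=
    tendsto_toL2_mul hX.tendsto hY.tendsto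
  have hnum : Tendsto (fun j => toL2 (-numOp (P j * R j))) atTop
      (𝓝 (mul42 X4 LY4 + mul42 Y4 LX4 + (2 : ℝ) • G)) := by
    refine (((tendsto_toL2_mul hX.tendsto hY.tendsto_ou).add
      (tendsto_toL2_mul hY.tendsto hX.tendsto_ou)).add (hG.const_smul 2)).congr fun j => ?_
    rw [← map_smul, ← map_add, ← map_add, numOp_mul]
    congr 1
    rw [MvPolynomial.smul_eq_C_mul, map_ofNat]
    ring
  -- closedness of the generator, applied to the products `P j * R j`
  have hou := ou_eq_of_tendsto hprod hnum
  have hmul : mulL2 X Y = mul42 X4 Y4 := by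
    have hae : mul42 X4 Y4 =ᵐ[wiener] fun ω => X ω * Y ω := by
      filter_upwards [coeFn_mul42 X4 Y4, hX.coe_eq, hY.coe_eq] with ω h1 h2 h3
      rw [h1, h2, h3]
    have hm : MemLp (fun ω => X ω * Y ω) 2 wiener := (memLp_congr_ae hae).1 (Lp.memLp _)
    rw [mulL2, dif_pos hm]
    exact Lp.ext (hm.coeFn_toLp.trans hae.symm)
  rw [← hmul] at hou
  filter_upwards [coeFn_mul42 X4 LY4, coeFn_mul42 Y4 LX4, hX.coe_eq, hY.coe_eq, hX.coe_ou_eq,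
    hY.coe_ou_eq, Lp.coeFn_add (mul42 X4 LY4 + mul42 Y4 LX4) ((2 : ℝ) • G),
    Lp.coeFn_add (mul42 X4 LY4) (mul42 Y4 LX4), Lp.coeFn_smul (2 : ℝ) G]
    with ω h1 h2 h3 h4 h5 h6 h7 h8 h9
  rw [Gam, hou, h7, Pi.add_apply, h8, Pi.add_apply, h9, h1, h2, h3, h4, h5, h6, Pi.smul_apply,
    smul_eq_mul]
  ring

/-- Approximation of a pair consisting of an element of a chaos and an element of `𝔻^∞` by
polynomials, together with the carré du champ. -/
lemma exists_poly_approx {q : ℕ} {X Y : L2} (hX : X ∈ chaos q) (hY : Y ∈ DInf)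
    {ε : ℝ≥0∞} (hε : 0 < ε) :
    ∃ P ∈ eig q, ∃ R : Poly,
      eLpNorm (fun ω => ev P ω - X ω) 2 wiener ≤ ε ∧
      eLpNorm (fun ω => ev R ω - Y ω) 2 wiener ≤ ε ∧
      eLpNorm (ev (gamma P R)) 2 wiener ≤ ε + eLpNorm (Gam X Y) 2 wiener := by
  rw [chaos_eq] at hX
  obtain ⟨P, hPq, hPX⟩ := exists_seq_of_mem_closure hX
  obtain ⟨X4, LX4, hXa⟩ :=
    exists_polyApprox_of_tendsto (fun j => totalDegree_le_of_mem_eig (hPq j)) hPX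
  obtain ⟨R, Y4, LY4, hYa⟩ := exists_polyApprox_of_mem_DInf hY
  obtain ⟨G, hGae, hG⟩ := tendsto_gamma hPq hPX hXa hYa
  have l1 : Tendsto (fun j => eLpNorm (fun ω => ev (P j) ω - X ω) 2 wiener) atTop (𝓝 0) := by
    refine ((Lp.tendsto_Lp_iff_tendsto_eLpNorm' _ _).1 hPX).congr fun j => eLpNorm_congr_ae ?_
    filter_upwards [coeFn_evLp 2 (by simp) (P j)] with ω h
    rw [Pi.sub_apply, h]
  have l2 := (tendsto_toL4_iff hYa.coe_eq).1 hYa.tendsto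
  have l3 : Tendsto (fun j => eLpNorm (fun ω => ev (gamma (P j) (R j)) ω - Gam X Y ω) 2 wiener)
      atTop (𝓝 0) := by
    refine ((Lp.tendsto_Lp_iff_tendsto_eLpNorm' _ _).1 hG).congr fun j => eLpNorm_congr_ae ?_
    filter_upwards [coeFn_evLp 2 (by simp) (gamma (P j) (R j)), hGae] with ω h h'
    rw [Pi.sub_apply, h, h']
  obtain ⟨j, ⟨h1, h2⟩, h3⟩ := (((l1.eventually (Iic_mem_nhds hε)).and
    (l2.eventually (Iic_mem_nhds hε))).and (l3.eventually (Iic_mem_nhds hε))).exists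
  refine ⟨P j, hPq j, R j, h1, le_trans (eLpNorm_le_eLpNorm_of_exponent_le (by norm_num)
    ((measurable_ev _).aestronglyMeasurable.sub (Lp.aestronglyMeasurable Y))) h2, ?_⟩
  have hGm : AEStronglyMeasurable (Gam X Y) wiener := (Lp.aestronglyMeasurable G).congr hGae
  refine le_trans ?_ (add_le_add_left h3 _)
  refine le_trans (le_of_eq ?_) (eLpNorm_add_le
    ((measurable_ev (gamma (P j) (R j))).aestronglyMeasurable.sub hGm) hGm (by norm_num))
  congr 1
  ext ω
  simp

/-! ### Convergence of moments -/

lemma integrable_ev_pow (P : Poly) (n : ℕ) : Integrable (fun ω => ev P ω ^ n) wiener := by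
  simpa only [funext (ev_pow P n)] using integrable_ev (P ^ n)

section Moments

variable {U : ℕ → (ℕ → ℝ) → ℝ} {v : ℝ≥0}

lemma tendsto_integral_bcf
    (h : TendstoInDistribution U atTop (id : ℝ → ℝ) (fun _ => wiener) (gaussianReal 0 v))
    (φ : ℝ →ᵇ ℝ) :
    Tendsto (fun n => ∫ ω, φ (U n ω) ∂wiener) atTop (𝓝 (∫ x, φ x ∂gaussianReal 0 v)) := by
  have h1 := ProbabilityMeasure.tendsto_iff_forall_integral_tendsto.1 h.tendsto φ
  simp only [ProbabilityMeasure.coe_mk, Measure.map_id] at h1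
  refine h1.congr fun n => ?_
  exact integral_map (h.forall_aemeasurable n) φ.continuous.aestronglyMeasurable

lemma tendsto_charFun_map
    (h : TendstoInDistribution U atTop (id : ℝ → ℝ) (fun _ => wiener) (gaussianReal 0 v))
    (t : ℝ) :
    Tendsto (fun n => charFun (wiener.map (U n)) t) atTop (𝓝 (charFun (gaussianReal 0 v) t)) := by
  have h1 := ProbabilityMeasure.tendsto_iff_tendsto_charFun.1 h.tendsto t
  simpa only [ProbabilityMeasure.coe_mk, Measure.map_id] using h1

lemma charFun_map_eq {W : (ℕ → ℝ) → ℝ} (hW : AEMeasurable W wiener) (t : ℝ) :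
    charFun (wiener.map W) t = ∫ ω, Complex.exp (t * W ω * Complex.I) ∂wiener := by
  rw [charFun_apply_real, integral_map hW (by fun_prop)]

lemma charFun_gaussianReal_zero (v : ℝ≥0) (t : ℝ) :
    charFun (gaussianReal 0 v) t = (Real.exp (-(v * t ^ 2 / 2)) : ℂ) := by
  rw [charFun_gaussianReal]
  push_cast
  congr 1
  ring

lemma exists_measure_gt_le
    (h : TendstoInDistribution U atTop (id : ℝ → ℝ) (fun _ => wiener) (gaussianReal 0 v))
    {δ : ℝ} (hδ : 0 < δ) :
    ∃ r : ℝ, 0 ≤ r ∧ ∀ n, (wiener.map (U n)).real {x | r < ‖x‖} ≤ δ := by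
  have hp : ∀ n, IsProbabilityMeasure (wiener.map (U n)) := fun n =>
    Measure.isProbabilityMeasure_map (h.forall_aemeasurable n)
  have ht : IsTightMeasureSet (Set.range fun n => wiener.map (U n)) :=
    isTightMeasureSet_of_tendsto_charFun (f := charFun (gaussianReal 0 v))
      (by fun_prop) (tendsto_charFun_map h)
  have ht' := isTightMeasureSet_iff_tendsto_measure_norm_gt.1 ht
  obtain ⟨r, hr, hr0⟩ := ((ht'.eventually (Iic_mem_nhds (ENNReal.ofReal_pos.2 hδ))).and
    (eventually_ge_atTop 0)).exists
  refine ⟨r, hr0, fun n => ?_⟩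
  have : wiener.map (U n) {x | r < ‖x‖} ≤ ENNReal.ofReal δ :=
    (le_iSup₂ (f := fun μ (_ : μ ∈ Set.range fun n => wiener.map (U n)) => μ {x | r < ‖x‖})
      (wiener.map (U n)) ⟨n, rfl⟩).trans hr
  exact ENNReal.toReal_le_of_le_ofReal hδ.le this

/-- Convergence in law upgrades to convergence of the expectations of a nonnegative continuous
function whose square has bounded expectations. -/
lemma tendsto_integral_of_sq_bounded
    (h : TendstoInDistribution U atTop (id : ℝ → ℝ) (fun _ => wiener) (gaussianReal 0 v))
    {f : ℝ → ℝ} (hf : Continuous f) (hf0 : ∀ x, 0 ≤ f x) {B : ℝ}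
    (hi : ∀ n, Integrable (fun ω => f (U n ω)) wiener)
    (hi2 : ∀ n, Integrable (fun ω => f (U n ω) ^ 2) wiener)
    (hB : ∀ n, ∫ ω, f (U n ω) ^ 2 ∂wiener ≤ B)
    (gi : Integrable f (gaussianReal 0 v)) (gi2 : Integrable (fun x => f x ^ 2) (gaussianReal 0 v)) :
    Tendsto (fun n => ∫ ω, f (U n ω) ∂wiener) atTop (𝓝 (∫ x, f x ∂gaussianReal 0 v)) := by
  set B' := max B (∫ x, f x ^ 2 ∂gaussianReal 0 v) with hB'
  have hB'0 : 0 ≤ B' := le_max_of_le_right (integral_nonneg fun x => sq_nonneg _)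
  -- truncating at height `M` costs at most `B' / M`, because `f - min f M ≤ f² / M`
  have trunc : ∀ M : ℝ, 0 < M → ∀ {Ω : Type} [MeasurableSpace Ω] (μ : Measure Ω)
      [IsProbabilityMeasure μ] (W : Ω → ℝ), AEMeasurable W μ →
      Integrable (fun ω => f (W ω)) μ → Integrable (fun ω => f (W ω) ^ 2) μ →
      ∫ ω, f (W ω) ^ 2 ∂μ ≤ B' →
      |∫ ω, f (W ω) ∂μ - ∫ ω, min (f (W ω)) M ∂μ| ≤ B' / M := by
    intro M hM Ω _ μ _ W hW h1 h2 h3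
    have hm : Integrable (fun ω => min (f (W ω)) M) μ := h1.inf (integrable_const M)
    rw [← integral_sub h1 hm, abs_of_nonneg
      (integral_nonneg fun ω => sub_nonneg.2 (min_le_left _ _))]
    calc ∫ ω, f (W ω) - min (f (W ω)) M ∂μ ≤ ∫ ω, f (W ω) ^ 2 / M ∂μ := by
          refine integral_mono (h1.sub hm) (h2.div_const M) fun ω => ?_
          have := hf0 (W ω)
          change f (W ω) - min (f (W ω)) M ≤ f (W ω) ^ 2 / M
          rw [le_div_iff₀ hM]
          rcases le_total (f (W ω)) M with hc | hc
          · rw [min_eq_left hc, sub_self, zero_mul]; positivity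
          · rw [min_eq_right hc]; nlinarith
      _ ≤ B' / M := by
          rw [integral_div]
          gcongr
  rw [Metric.tendsto_atTop]
  intro ε hε
  set M := 3 * (B' + 1) / ε with hMdef
  have hM : 0 < M := by positivity
  have hBM : B' / M < ε / 3 := by
    rw [div_lt_iff₀ hM, hMdef]
    have : ε / 3 * (3 * (B' + 1) / ε) = B' + 1 := by field_simp
    linarith
  let φ : ℝ →ᵇ ℝ := BoundedContinuousFunction.ofNormedAddCommGroup (fun x => min (f x) M)
    (hf.min continuous_const) M fun x => by
      rw [Real.norm_eq_abs, abs_of_nonneg (le_min (hf0 x) hM.le)]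
      exact min_le_right _ _
  obtain ⟨N, hN⟩ := Metric.tendsto_atTop.1 (tendsto_integral_bcf h φ) (ε / 3) (by positivity)
  refine ⟨N, fun n hn => ?_⟩
  have a1 := trunc M hM wiener (U n) (h.forall_aemeasurable n) (hi n) (hi2 n)
    ((hB n).trans (le_max_left _ _))
  have a2 := trunc M hM (gaussianReal 0 v) id aemeasurable_id gi gi2 (le_max_right _ _)
  have a3 := hN n hn
  rw [Real.dist_eq] at a3 ⊢
  change |∫ ω, min (f (U n ω)) M ∂wiener - ∫ x, min (f x) M ∂gaussianReal 0 v| < _ at a3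
  simp only [id] at a2
  rw [abs_lt] at *
  rw [abs_le] at a1 a2
  constructor <;> linarith [a1.1, a1.2, a2.1, a2.2, a3.1, a3.2]

end Moments

lemma integrable_pow_gaussianReal (n : ℕ) (v : ℝ≥0) :
    Integrable (fun x => x ^ n) (gaussianReal 0 v) := by
  have := (memLp_id_gaussianReal' (μ := 0) (v := v) (n : ℝ≥0∞) (by simp)).integrable_norm_pow'
  rw [← integrable_norm_iff (by fun_prop)]
  simpa using this

lemma integral_pow_gaussianReal (n : ℕ) (v : ℝ≥0) :
    ∫ x, x ^ n ∂gaussianReal 0 v = √v ^ n * ∫ x, x ^ n ∂gaussianReal 0 1 := by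
  have h : gaussianReal 0 v = (gaussianReal 0 1).map (√v * ·) := by
    rw [gaussianReal_map_const_mul]
    congr 1
    · simp
    · ext; simp
  rw [h, integral_map (by fun_prop) (by fun_prop), ← integral_const_mul]
  simp_rw [mul_pow]

lemma integral_sq_gaussianReal (v : ℝ≥0) : ∫ x, x ^ 2 ∂gaussianReal 0 v = v := by
  have h := integral_gaussianReal_deriv (u := fun x : ℝ => x) (u' := fun _ => 1)
    (fun x => hasDerivAt_id' x) (by simpa using integrable_pow_gaussianReal 1 1)
    (integrable_const _) (by simpa [← sq] using integrable_pow_gaussianReal 2 1)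
  rw [integral_pow_gaussianReal, Real.sq_sqrt v.coe_nonneg]
  simp only [smul_eq_mul, ← sq] at h
  rw [← h]; simp

lemma integral_pow_four_gaussianReal (v : ℝ≥0) : ∫ x, x ^ 4 ∂gaussianReal 0 v = 3 * v ^ 2 := by
  have h := integral_gaussianReal_deriv (u := fun x : ℝ => x ^ 3) (u' := fun x => 3 * x ^ 2)
    (fun x => by simpa using hasDerivAt_pow 3 x) (integrable_pow_gaussianReal 3 1)
    ((integrable_pow_gaussianReal 2 1).const_mul 3)
    (by simpa [← pow_succ'] using integrable_pow_gaussianReal 4 1)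
  rw [integral_const_mul, integral_sq_gaussianReal] at h
  rw [integral_pow_gaussianReal, show √(v : ℝ) ^ 4 = (√(v : ℝ) ^ 2) ^ 2 by ring, Real.sq_sqrt v.coe_nonneg]
  simp only [smul_eq_mul, ← pow_succ'] at h
  rw [← h]; simp; ring

section PolyMoments

variable {q : ℕ} {v : ℝ≥0} {P : ℕ → Poly}

/-- A sequence in a fixed chaos converging in law is bounded in `L²`: by hypercontractivity, only a
fraction of the second moment can come from the small set where the variable is large. -/
lemma exists_Ex_sq_le (hP : ∀ n, P n ∈ eig q)
    (h : TendstoInDistribution (fun n => ev (P n)) atTop (id : ℝ → ℝ) (fun _ => wiener)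
      (gaussianReal 0 v)) :
    ∃ B : ℝ, ∀ n, Ex (P n ^ 2) ≤ B := by
  obtain ⟨C, hC, hyp⟩ := exists_Ex_pow_four_le q
  obtain ⟨r, hr, hδ⟩ := exists_measure_gt_le h (δ := 1 / (4 * (C + 1))) (by positivity)
  refine ⟨2 * r ^ 2, fun n => ?_⟩
  set e := Ex (P n ^ 2) with he
  rcases (Ex_sq_nonneg (P n)).eq_or_lt with h0 | h0
  · rw [he, ← h0]; positivity
  rw [← he] at h0
  have h4 : Ex (P n ^ 4) ≤ (C + 1) * e ^ 2 :=
    (hyp _ (totalDegree_le_of_mem_eig (hP n))).trans (by nlinarith [sq_nonneg e])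
  have hC1 : 0 < C + 1 := by linarith
  -- on `{|P n| > r}` use `x² ≤ a x⁴ + 1 / (4 a)`; with this `a` both terms contribute at most `e / 4`
  set a := 1 / (4 * (C + 1) * e) with ha
  have ha0 : 0 < a := by positivity
  set A : Set (ℕ → ℝ) := {ω | r < ‖ev (P n) ω‖} with hA
  have hAm : MeasurableSet A := measurableSet_lt measurable_const (measurable_ev (P n)).norm
  have hAδ : wiener.real A ≤ 1 / (4 * (C + 1)) := by
    have := hδ n
    rwa [map_measureReal_apply (measurable_ev (P n))
      (measurableSet_lt measurable_const measurable_norm)] at this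
  have hind : Integrable (A.indicator fun _ => 1 / (4 * a)) wiener :=
    (integrable_const _).indicator hAm
  have i4 : Integrable (fun ω => a * ev (P n) ω ^ 4) wiener := 
    (integrable_ev_pow (P n) 4).const_mul a
  have key : e ≤ r ^ 2 + (a * Ex (P n ^ 4) + 1 / (4 * a) * wiener.real A) := by
    calc e ≤ ∫ ω, r ^ 2 + (a * ev (P n) ω ^ 4 + A.indicator (fun _ => 1 / (4 * a)) ω) ∂wiener := by
          refine integral_mono (integrable_ev _) ((integrable_const _).add (i4.add hind))
            fun ω => ?_
          simp only [ev_pow]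
          have hx4 : 0 ≤ a * ev (P n) ω ^ 4 := by positivity
          by_cases hω : ω ∈ A
          · rw [Set.indicator_of_mem hω]
            have h5 : 0 ≤ a * (ev (P n) ω ^ 2 - 1 / (2 * a)) ^ 2 := by positivity
            have h6 : a * (ev (P n) ω ^ 2 - 1 / (2 * a)) ^ 2 =
                a * ev (P n) ω ^ 4 - ev (P n) ω ^ 2 + 1 / (4 * a) := by
              field_simp; ring
            nlinarith [sq_nonneg r]
          · rw [Set.indicator_of_notMem hω]
            have h5 : |ev (P n) ω| ≤ r := by simpa [hA] using hω
            have := sq_le_sq' (neg_le_of_abs_le h5) (le_of_abs_le h5)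
            linarith
      _ = r ^ 2 + (a * Ex (P n ^ 4) + 1 / (4 * a) * wiener.real A) := by
          rw [integral_add (g := fun ω => a * ev (P n) ω ^ 4 + A.indicator (fun _ => 1 / (4 * a)) ω)
            (integrable_const _) (i4.add hind), integral_add i4 hind,
            integral_const_mul, integral_indicator_const _ hAm, Ex_def]
          simp [mul_comm]
  have k1 : a * Ex (P n ^ 4) ≤ e / 4 := by
    calc a * Ex (P n ^ 4) ≤ a * ((C + 1) * e ^ 2) := by gcongr
      _ = e / 4 := by rw [ha]; field_simp
  have k2 : 1 / (4 * a) * wiener.real A ≤ e / 4 := by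
    calc 1 / (4 * a) * wiener.real A ≤ 1 / (4 * a) * (1 / (4 * (C + 1))) := by gcongr
      _ = e / 4 := by rw [ha]; field_simp
  linarith

/-- For a sequence in a fixed chaos converging in law to a centred Gaussian variable, the second and
fourth moments converge. -/
lemma tendsto_moments (hP : ∀ n, P n ∈ eig q)
    (h : TendstoInDistribution (fun n => ev (P n)) atTop (id : ℝ → ℝ) (fun _ => wiener)
      (gaussianReal 0 v)) :
    Tendsto (fun n => Ex (P n ^ 2)) atTop (𝓝 v) ∧
      Tendsto (fun n => Ex (P n ^ 4)) atTop (𝓝 (3 * (v : ℝ) ^ 2)) := by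
  obtain ⟨B, hB⟩ := exists_Ex_sq_le hP h
  obtain ⟨C, hC, hyp⟩ := exists_Ex_pow_four_le q
  obtain ⟨C', hC', hyp'⟩ := exists_Ex_pow_four_le (2 * q)
  have b4 : ∀ n, Ex (P n ^ 4) ≤ C * B ^ 2 := fun n =>
    (hyp _ (totalDegree_le_of_mem_eig (hP n))).trans (by
      have := Ex_sq_nonneg (P n)
      have := hB n
      gcongr)
  have b8 : ∀ n, Ex (P n ^ 8) ≤ C' * (C * B ^ 2) ^ 2 := fun n => by
    have h1 := hyp' (P n ^ 2) ((MvPolynomial.totalDegree_pow _ 2).trans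
      (Nat.mul_le_mul_left 2 (totalDegree_le_of_mem_eig (hP n))))
    simp only [← pow_mul] at h1
    refine h1.trans ?_
    have := Ex_pow_four_nonneg (P n)
    have := b4 n
    norm_num
    gcongr
  constructor
  · have := tendsto_integral_of_sq_bounded h (f := fun x => x ^ 2) (by fun_prop)
      (fun x => sq_nonneg x) (B := C * B ^ 2)
      (fun n => by simpa using integrable_ev_pow (P n) 2)
      (fun n => by simpa [← pow_mul] using integrable_ev_pow (P n) 4)
      (fun n => by simpa [← pow_mul, Ex_def] using b4 n) (integrable_pow_gaussianReal 2 v)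
      (by simpa [← pow_mul] using integrable_pow_gaussianReal 4 v)
    rw [integral_sq_gaussianReal] at this
    simpa [Ex_def] using this
  · have := tendsto_integral_of_sq_bounded h (f := fun x => x ^ 4) (by fun_prop)
      (fun x => by positivity) (B := C' * (C * B ^ 2) ^ 2)
      (fun n => by simpa using integrable_ev_pow (P n) 4)
      (fun n => by simpa [← pow_mul] using integrable_ev_pow (P n) 8)
      (fun n => by simpa [← pow_mul, Ex_def] using b8 n) (integrable_pow_gaussianReal 4 v)
      (by simpa [← pow_mul] using integrable_pow_gaussianReal 8 v)
    rw [integral_pow_four_gaussianReal] at this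
    simpa [Ex_def] using this

/-- The fourth moment theorem: `Γ(P n, P n) → q v` in `L²`. -/
lemma tendsto_gamma_self (hP : ∀ n, P n ∈ eig q)
    (h : TendstoInDistribution (fun n => ev (P n)) atTop (id : ℝ → ℝ) (fun _ => wiener)
      (gaussianReal 0 v)) :
    Tendsto (fun n => Ex ((gamma (P n) (P n) - MvPolynomial.C (q * (v : ℝ))) ^ 2)) atTop (𝓝 0) := by
  obtain ⟨h2, h4⟩ := tendsto_moments hP h
  refine squeeze_zero (fun n => Ex_sq_nonneg _) (fun n => Ex_gamma_self_sub_sq_le (hP n) v) ?_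
  have := (((h4.div_const 3).sub (h2.const_mul (2 * (v : ℝ)))).add_const ((v : ℝ) ^ 2)).const_mul
    ((q : ℝ) ^ 2)
  refine this.congr' (Eventually.of_forall fun n => rfl) |>.trans (le_of_eq ?_)
  congr 1
  ring

end PolyMoments

/-! ### Weighted characteristic functions -/

section CharFun

/-- The integrand `exp(i t P) ψ(R)` of the characteristic function of `P` weighted by `ψ(R)`. -/
noncomputable def expW (ψ : ℝ → ℝ) (P R : Poly) (t : ℝ) (ω : ℕ → ℝ) : ℂ :=
  Complex.exp (t * ev P ω * Complex.I) * ψ (ev R ω)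

lemma norm_exp_mul_mul_I (a b : ℝ) : ‖Complex.exp (a * b * Complex.I)‖ = 1 := by
  rw [← Complex.ofReal_mul, Complex.norm_exp_ofReal_mul_I]

lemma norm_expW (ψ : ℝ → ℝ) (P R : Poly) (t : ℝ) (ω : ℕ → ℝ) :
    ‖expW ψ P R t ω‖ = |ψ (ev R ω)| := by
  rw [expW, norm_mul, norm_exp_mul_mul_I, one_mul, Complex.norm_real, Real.norm_eq_abs]

lemma measurable_expW {ψ : ℝ → ℝ} (hψ : Measurable ψ) (P R : Poly) (t : ℝ) :
    Measurable (expW ψ P R t) := by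
  have h1 := measurable_ev P
  have h2 := measurable_ev R
  unfold expW
  fun_prop

lemma integrable_ev_mul_expW {ψ : ℝ → ℝ} (hψ : Measurable ψ) {B : ℝ} (hB : ∀ x, |ψ x| ≤ B)
    (Q P R : Poly) (t : ℝ) : Integrable (fun ω => (ev Q ω : ℂ) * expW ψ P R t ω) wiener := by
  refine (integrable_ev Q).ofReal.mul_bdd (c := B)
    (measurable_expW hψ P R t).aestronglyMeasurable (ae_of_all _ fun ω => ?_)
  rw [norm_expW]
  exact hB _

lemma hasDerivAt_expW {ψ ψ' : ℝ → ℝ} (hψ : ∀ x, HasDerivAt ψ (ψ' x) x) (P R : Poly) (t : ℝ)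
    (i : ℕ) (ω : ℕ → ℝ) :
    HasDerivAt (fun x => expW ψ P R t (Function.update ω i x))
      (t * Complex.I * (ev (pderiv i P) ω * expW ψ P R t ω) +
        ev (pderiv i R) ω * expW ψ' P R t ω) (ω i) := by
  have hP := (hasDerivAt_ev P i ω).ofReal_comp
  have hR := hasDerivAt_ev R i ω
  have h1 := ((hP.const_mul (t : ℂ)).mul_const Complex.I).cexp
  have h2 : HasDerivAt (fun x => ψ (ev R (Function.update ω i x)))
      (ψ' (ev R ω) * ev (pderiv i R) ω) (ω i) := by
    have := hψ (ev R (Function.update ω i (ω i)))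
    rw [Function.update_eq_self] at this
    exact HasDerivAt.comp (ω i) (by rwa [Function.update_eq_self]) hR
  refine (h1.mul h2.ofReal_comp).congr_deriv ?_
  simp only [Function.update_eq_self, expW]
  push_cast
  ring

variable {q : ℕ} {P : Poly} {ψ ψ' : ℝ → ℝ} {B B' : ℝ}

/-- Integration by parts for `exp(i t P) ψ(R)`. -/
lemma integral_mul_expW (hP : P ∈ eig q) (R : Poly) (hψ : ∀ x, HasDerivAt ψ (ψ' x) x)
    (hψ' : Measurable ψ') (hB : ∀ x, |ψ x| ≤ B) (hB' : ∀ x, |ψ' x| ≤ B') (t : ℝ) :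
    q * ∫ ω, ev P ω * expW ψ P R t ω ∂wiener =
      t * Complex.I * ∫ ω, ev (gamma P P) ω * expW ψ P R t ω ∂wiener +
        ∫ ω, ev (gamma P R) ω * expW ψ' P R t ω ∂wiener := by
  have hψm : Measurable ψ :=
    (continuous_iff_continuousAt.2 fun x => (hψ x).continuousAt).measurable
  have hi := fun Q => integrable_ev_mul_expW hψm hB Q P R t
  have hi' := fun Q => integrable_ev_mul_expW hψ' hB' Q P R t
  have key := integral_numOp_smul P (fun i ω => hasDerivAt_expW hψ P R t i ω)
    (fun Q => by simpa [Complex.real_smul] using hi Q)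
    (fun Q i => by
      have := ((hi (Q * pderiv i P)).const_mul (t * Complex.I)).add (hi' (Q * pderiv i R))
      refine this.congr (ae_of_all _ fun ω => ?_)
      simp only [Pi.add_apply, ev_mul, Complex.real_smul]
      push_cast
      ring)
  rw [numOp_of_mem_eig hP] at key
  rw [← integral_const_mul, ← integral_const_mul, ← integral_add ((hi _).const_mul _) (hi' _)]
  convert key using 1
  · refine integral_congr_ae (ae_of_all _ fun ω => ?_)
    simp only [ev_smul, Complex.real_smul]
    push_cast
    ring
  · refine integral_congr_ae (ae_of_all _ fun ω => ?_)
    simp only [gamma, ev_sum, ev_mul, Complex.real_smul]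
    push_cast
    rw [Finset.sum_mul, Finset.sum_mul, Finset.mul_sum, ← Finset.sum_add_distrib]
    refine Finset.sum_congr rfl fun i _ => ?_
    ring

lemma hasDerivAt_integral_expW (P R : Poly) (hψ : Measurable ψ) (hB : ∀ x, |ψ x| ≤ B) (t : ℝ) :
    HasDerivAt (fun t => ∫ ω, expW ψ P R t ω ∂wiener)
      (Complex.I * ∫ ω, ev P ω * expW ψ P R t ω ∂wiener) t := by
  rw [← integral_const_mul]
  have hi := fun s => integrable_ev_mul_expW hψ hB P P R s
  refine (hasDerivAt_integral_of_dominated_loc_of_deriv_le (s := Set.univ)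
    (F := fun t ω => expW ψ P R t ω)
    (F' := fun t ω => Complex.I * (ev P ω * expW ψ P R t ω))
    (bound := fun ω => |ev P ω| * B) univ_mem
    (Eventually.of_forall fun s => (measurable_expW hψ P R s).aestronglyMeasurable) ?_
    ((hi t).const_mul _).aestronglyMeasurable (ae_of_all _ fun ω s _ => ?_)
    ((integrable_ev P).abs.mul_const B) (ae_of_all _ fun ω s _ => ?_)).2
  · have := integrable_ev_mul_expW hψ hB 1 P R t
    simpa [ev] using this
  · rw [norm_mul, norm_mul, norm_expW, Complex.norm_I, one_mul, Complex.norm_real,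
      Real.norm_eq_abs]
    exact mul_le_mul_of_nonneg_left (hB _) (abs_nonneg _)
  · have h1 := (((hasDerivAt_id' s).ofReal_comp.mul_const (ev P ω : ℂ)).mul_const
      Complex.I).cexp.mul_const (ψ (ev R ω) : ℂ)
    refine h1.congr_deriv ?_
    simp only [expW]
    push_cast
    ring

lemma norm_integral_ev_mul_expW_le {χ : ℝ → ℝ} {b : ℝ} (hχ : ∀ x, |χ x| ≤ b) (Q P R : Poly)
    (t : ℝ) : ‖∫ ω, ev Q ω * expW χ P R t ω ∂wiener‖ ≤ b * √(Ex (Q ^ 2)) := by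
  have hb : 0 ≤ b := (abs_nonneg _).trans (hχ 0)
  have h1 : ∫ ω, |ev Q ω| ∂wiener ≤ √(Ex (Q ^ 2)) := by
    refine Real.le_sqrt_of_sq_le ?_
    have hL : MemLp (fun ω => |ev Q ω|) 2 wiener := (memLp_ev Q (by simp)).abs
    have := variance_nonneg (fun ω => |ev Q ω|) wiener
    rw [variance_eq_sub hL, sub_nonneg] at this
    refine this.trans (le_of_eq ?_)
    rw [Ex_def]
    simp
  calc _ ≤ ∫ ω, |ev Q ω| * b ∂wiener := by
        refine norm_integral_le_of_norm_le ((integrable_ev Q).abs.mul_const b)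
          (ae_of_all _ fun ω => ?_)
        rw [norm_mul, norm_expW, Complex.norm_real, Real.norm_eq_abs]
        exact mul_le_mul_of_nonneg_left (hχ _) (abs_nonneg _)
    _ ≤ b * √(Ex (Q ^ 2)) := by
        rw [integral_mul_const, mul_comm]
        gcongr

/-- The weighted characteristic function of `P` satisfies up to a small error the differential
equation `g' = - t v g`, and is therefore close to that of a Gaussian variable. -/
lemma norm_integral_expW_sub_le (hq : q ≠ 0) (hP : P ∈ eig q) (R : Poly)
    (hψ : ∀ x, HasDerivAt ψ (ψ' x) x) (hψ' : Measurable ψ') (hB : ∀ x, |ψ x| ≤ B)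
    (hB' : ∀ x, |ψ' x| ≤ B') (v : ℝ≥0) (t : ℝ) :
    ‖∫ ω, expW ψ P R t ω ∂wiener -
        (Real.exp (-(v * t ^ 2 / 2)) : ℂ) * ∫ ω, (ψ (ev R ω) : ℂ) ∂wiener‖ ≤
      |t| * (|t| * (B * √(Ex ((gamma P P - MvPolynomial.C (q * (v : ℝ))) ^ 2))) +
        B' * √(Ex (gamma P R ^ 2))) := by
  have hB0 : 0 ≤ B := (abs_nonneg _).trans (hB 0)
  have hB0' : 0 ≤ B' := (abs_nonneg _).trans (hB' 0)
  have hψm : Measurable ψ :=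
    (continuous_iff_continuousAt.2 fun x => (hψ x).continuousAt).measurable
  set D := gamma P P - MvPolynomial.C (q * (v : ℝ)) with hD
  set a := B * √(Ex (D ^ 2)) with ha
  set b := B' * √(Ex (gamma P R ^ 2)) with hb
  have ha0 : 0 ≤ a := by positivity
  have hb0 : 0 ≤ b := by positivity
  set g : ℝ → ℂ := fun s => ∫ ω, expW ψ P R s ω ∂wiener with hg
  set g' : ℝ → ℂ := fun s => Complex.I * ∫ ω, ev P ω * expW ψ P R s ω ∂wiener with hg'
  have hgd : ∀ s, HasDerivAt g (g' s) s := fun s => hasDerivAt_integral_expW P R hψm hB s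
  have hi1 : ∀ s, Integrable (expW ψ P R s) wiener := fun s => by
    simpa [ev] using integrable_ev_mul_expW hψm hB 1 P R s
  have err : ∀ s, ‖g' s + s * v * g s‖ ≤ |s| * a + b := by
    intro s
    have e1 := integral_mul_expW hP R hψ hψ' hB hB' s
    have e2 : ∫ ω, ev D ω * expW ψ P R s ω ∂wiener =
        ∫ ω, ev (gamma P P) ω * expW ψ P R s ω ∂wiener - q * v * g s := by
      rw [hg, ← integral_const_mul,
        ← integral_sub (integrable_ev_mul_expW hψm hB _ P R s) ((hi1 s).const_mul _)]
      refine integral_congr_ae (ae_of_all _ fun ω => ?_)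
      simp only [hD, ev_sub, ev_C]
      push_cast
      ring
    have e3 : (q : ℂ) * (g' s + s * v * g s) =
        -(s * ∫ ω, ev D ω * expW ψ P R s ω ∂wiener) +
          Complex.I * ∫ ω, ev (gamma P R) ω * expW ψ' P R s ω ∂wiener := by
      have e4 : (q : ℂ) * (g' s + s * v * g s) =
          Complex.I * (q * ∫ ω, ev P ω * expW ψ P R s ω ∂wiener) + q * s * v * g s := by
        rw [hg']; ring
      rw [e4, e1, e2]
      linear_combination (s : ℂ) * (∫ ω, ev (gamma P P) ω * expW ψ P R s ω ∂wiener) *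
        Complex.I_sq
    have e5 : (q : ℝ) * ‖g' s + s * v * g s‖ ≤ |s| * a + b := by
      have := congrArg norm e3
      rw [norm_mul, Complex.norm_natCast] at this
      rw [this]
      refine (norm_add_le _ _).trans (add_le_add ?_ ?_)
      · rw [norm_neg, norm_mul, Complex.norm_real, Real.norm_eq_abs]
        exact mul_le_mul_of_nonneg_left (norm_integral_ev_mul_expW_le hB _ _ _ _) (abs_nonneg _)
      · rw [norm_mul, Complex.norm_I, one_mul]
        exact norm_integral_ev_mul_expW_le hB' _ _ _ _
    have hq1 : (1 : ℝ) ≤ q := by exact_mod_cast Nat.one_le_iff_ne_zero.2 hq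
    nlinarith [norm_nonneg (g' s + s * v * g s)]
  -- multiply by the integrating factor
  set E : ℝ → ℝ := fun s => Real.exp (v * s ^ 2 / 2) with hE
  have hEd : ∀ s, HasDerivAt E (E s * (v * s)) s := by
    intro s
    refine (((hasDerivAt_pow 2 s).const_mul (v : ℝ)).div_const 2).exp.congr_deriv ?_
    simp only [hE]
    push_cast
    ring
  have hGd : ∀ s, HasDerivAt (fun s => (E s : ℂ) * g s) (E s * (g' s + s * v * g s)) s := by
    intro s
    refine ((hEd s).ofReal_comp.mul (hgd s)).congr_deriv ?_
    push_cast
    ring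
  have hlip := Convex.norm_image_sub_le_of_norm_hasDerivWithin_le
    (f := fun s => (E s : ℂ) * g s) (s := Metric.closedBall (0 : ℝ) |t|)
    (C := E t * (|t| * a + b)) (x := 0) (y := t) (fun s _ => (hGd s).hasDerivWithinAt)
    (fun s hs => by
      have hs' : |s| ≤ |t| := by simpa using hs
      have hst : s ^ 2 ≤ t ^ 2 := sq_le_sq.2 hs'
      rw [norm_mul, Complex.norm_real, Real.norm_eq_abs, abs_of_pos (Real.exp_pos _)]
      have h1 : E s ≤ E t := Real.exp_le_exp.2 (by
        have := v.coe_nonneg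
        nlinarith)
      have h2 : ‖g' s + s * v * g s‖ ≤ |t| * a + b :=
        (err s).trans (by gcongr)
      exact mul_le_mul h1 h2 (norm_nonneg _) (Real.exp_pos _).le)
    (convex_closedBall _ _) (by simp) (by simp)
  have hE0 : E 0 = 1 := by simp [hE]
  have hg0 : g 0 = ∫ ω, (ψ (ev R ω) : ℂ) ∂wiener := by simp [hg, expW]
  rw [hE0, hg0, Complex.ofReal_one, one_mul, sub_zero, Real.norm_eq_abs] at hlip
  have hEt : (Real.exp (-(v * t ^ 2 / 2)) : ℂ) * (E t : ℂ) = 1 := by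
    rw [← Complex.ofReal_mul, ← Real.exp_add]; simp
  have e6 : g t - (Real.exp (-(v * t ^ 2 / 2)) : ℂ) * ∫ ω, (ψ (ev R ω) : ℂ) ∂wiener =
      (Real.exp (-(v * t ^ 2 / 2)) : ℂ) * (E t * g t - ∫ ω, (ψ (ev R ω) : ℂ) ∂wiener) := by
    rw [mul_sub, ← mul_assoc, hEt, one_mul]
  rw [e6, norm_mul, Complex.norm_real, Real.norm_eq_abs, abs_of_pos (Real.exp_pos _)]
  calc _ ≤ Real.exp (-(v * t ^ 2 / 2)) * (E t * (|t| * a + b) * |t|) := by gcongr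
    _ = (Real.exp (-(v * t ^ 2 / 2)) * E t) * (|t| * (|t| * a + b)) := by ring
    _ = |t| * (|t| * a + b) := by
        have : Real.exp (-(v * t ^ 2 / 2)) * E t = 1 := by exact_mod_cast hEt
        rw [this, one_mul]

end CharFun

lemma tendsto_charFun_poly {q : ℕ} {v : ℝ≥0} {P R : ℕ → Poly} (hP : ∀ n, P n ∈ eig q)
    (h : TendstoInDistribution (fun n => ev (P n)) atTop (id : ℝ → ℝ) (fun _ => wiener)
      (gaussianReal 0 v))
    (hΓ : Tendsto (fun n => √(Ex (gamma (P n) (R n) ^ 2))) atTop (𝓝 0))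
    {ψ ψ' : ℝ → ℝ} {B B' : ℝ} (hψ : ∀ x, HasDerivAt ψ (ψ' x) x) (hψ' : Measurable ψ')
    (hB : ∀ x, |ψ x| ≤ B) (hB' : ∀ x, |ψ' x| ≤ B') (t : ℝ) :
    Tendsto (fun n => ∫ ω, expW ψ (P n) (R n) t ω ∂wiener -
      (Real.exp (-(v * t ^ 2 / 2)) : ℂ) * ∫ ω, (ψ (ev (R n) ω) : ℂ) ∂wiener) atTop (𝓝 0) := by
  rw [tendsto_zero_iff_norm_tendsto_zero]
  rcases eq_or_ne q 0 with rfl | hq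
  · -- the elements of the chaos of degree zero are constants
    choose c hc using fun n => exists_eq_C_of_mem_eig_zero (hP n)
    have h1 := (tendsto_charFun_map h t).sub_const (charFun (gaussianReal 0 v) t)
    rw [sub_self, tendsto_zero_iff_norm_tendsto_zero] at h1
    refine squeeze_zero (fun _ => norm_nonneg _) (fun n => ?_) (by simpa using h1.mul_const B)
    have h2 : charFun (wiener.map (ev (P n))) t = Complex.exp (t * c n * Complex.I) := by
      rw [charFun_map_eq (measurable_ev _).aemeasurable, hc n]
      simp
    have h3 : ∫ ω, expW ψ (P n) (R n) t ω ∂wiener =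
        Complex.exp (t * c n * Complex.I) * ∫ ω, (ψ (ev (R n) ω) : ℂ) ∂wiener := by
      rw [← integral_const_mul]
      refine integral_congr_ae (ae_of_all _ fun ω => ?_)
      simp [expW, hc n]
    rw [h2, h3, charFun_gaussianReal_zero, ← sub_mul, norm_mul]
    refine mul_le_mul_of_nonneg_left ?_ (norm_nonneg _)
    have := norm_integral_le_of_norm_le_const (μ := wiener) (f := fun ω => (ψ (ev (R n) ω) : ℂ))
      (C := B) (ae_of_all _ fun ω => by
        rw [Complex.norm_real]; exact hB _)
    simpa using this
  · have h1 : Tendsto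
        (fun n => √(Ex ((gamma (P n) (P n) - MvPolynomial.C (q * (v : ℝ))) ^ 2))) atTop (𝓝 0) := by
      have := (Real.continuous_sqrt.tendsto 0).comp (tendsto_gamma_self hP h)
      rwa [Real.sqrt_zero] at this
    refine squeeze_zero (fun _ => norm_nonneg _)
      (fun n => norm_integral_expW_sub_le hq (hP n) (R n) hψ hψ' hB hB' v t) ?_
    have := (((h1.const_mul B).const_mul |t|).add (hΓ.const_mul B')).const_mul |t|
    simpa using this

/-! ### Weighted characteristic functions of random variables in a chaos -/

lemma measurable_L2 (F : L2) : Measurable F := (Lp.stronglyMeasurable F).measurable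

lemma integral_abs_sub_le {f g : (ℕ → ℝ) → ℝ} (hf : AEStronglyMeasurable f wiener)
    (hg : AEStronglyMeasurable g wiener) {ε : ℝ} (hε : 0 ≤ ε)
    (h : eLpNorm (fun ω => f ω - g ω) 2 wiener ≤ ENNReal.ofReal ε) :
    Integrable (fun ω => f ω - g ω) wiener ∧ ∫ ω, |f ω - g ω| ∂wiener ≤ ε := by
  have h1 : eLpNorm (fun ω => f ω - g ω) 1 wiener ≤ ENNReal.ofReal ε :=
    (eLpNorm_le_eLpNorm_of_exponent_le (by norm_num) (hf.sub hg)).trans h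
  refine ⟨memLp_one_iff_integrable.1 ⟨hf.sub hg, h1.trans_lt ENNReal.ofReal_lt_top⟩, ?_⟩
  have h2 := integral_norm_eq_lintegral_enorm (hf.sub hg)
  rw [eLpNorm_one_eq_lintegral_enorm] at h1
  change ∫ ω, ‖f ω - g ω‖ ∂wiener ≤ ε
  exact (le_of_eq h2).trans (ENNReal.toReal_le_of_le_ofReal hε h1)

lemma norm_exp_sub_exp_le (t a b : ℝ) :
    ‖Complex.exp (t * a * Complex.I) - Complex.exp (t * b * Complex.I)‖ ≤ |t| * |a - b| := by
  have h : Complex.exp (t * a * Complex.I) - Complex.exp (t * b * Complex.I) =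
      Complex.exp (t * b * Complex.I) *
        (Complex.exp (Complex.I * ((t * (a - b) : ℝ) : ℂ)) - 1) := by
    rw [mul_sub, ← Complex.exp_add, mul_one]
    congr 2
    push_cast
    ring
  rw [h, norm_mul, norm_exp_mul_mul_I, one_mul]
  refine Real.norm_exp_I_mul_ofReal_sub_one_le.trans (le_of_eq ?_)
  rw [Real.norm_eq_abs, abs_mul]

lemma integrable_exp_mul {X Y : (ℕ → ℝ) → ℝ} (hX : Measurable X) (hY : Measurable Y) {ψ : ℝ → ℝ}
    (hψ : Measurable ψ) {B : ℝ} (hB : ∀ x, |ψ x| ≤ B) (t : ℝ) :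
    Integrable (fun ω => Complex.exp (t * X ω * Complex.I) * ψ (Y ω)) wiener := by
  refine Integrable.of_bound (C := B) ?_ (ae_of_all _ fun ω => ?_)
  · exact Measurable.aestronglyMeasurable (by fun_prop)
  · rw [norm_mul, norm_exp_mul_mul_I, one_mul, Complex.norm_real]
    exact hB _

/-- Stability of weighted characteristic functions under perturbations. -/
lemma norm_integral_exp_mul_sub_le {X X' Y Y' : (ℕ → ℝ) → ℝ} (hX : Measurable X)
    (hX' : Measurable X') (hY : Measurable Y) (hY' : Measurable Y')
    {ψ : ℝ → ℝ} (hψ : Measurable ψ) {B K ε : ℝ} (hB : ∀ x, |ψ x| ≤ B)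
    (hK : ∀ x y, |ψ x - ψ y| ≤ K * |x - y|) (hK0 : 0 ≤ K)
    (iX : Integrable (fun ω => X ω - X' ω) wiener) (iY : Integrable (fun ω => Y ω - Y' ω) wiener)
    (dX : ∫ ω, |X ω - X' ω| ∂wiener ≤ ε) (dY : ∫ ω, |Y ω - Y' ω| ∂wiener ≤ ε) (t : ℝ) :
    ‖∫ ω, Complex.exp (t * X ω * Complex.I) * ψ (Y ω) ∂wiener -
      ∫ ω, Complex.exp (t * X' ω * Complex.I) * ψ (Y' ω) ∂wiener‖ ≤ (|t| * B + K) * ε := by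
  have hB0 : 0 ≤ B := (abs_nonneg _).trans (hB 0)
  rw [← integral_sub (integrable_exp_mul hX hY hψ hB t) (integrable_exp_mul hX' hY' hψ hB t)]
  calc _ ≤ ∫ ω, |t| * B * |X ω - X' ω| + K * |Y ω - Y' ω| ∂wiener := by
        refine norm_integral_le_of_norm_le
          ((iX.abs.const_mul _).add (iY.abs.const_mul _)) (ae_of_all _ fun ω => ?_)
        have e : Complex.exp (t * X ω * Complex.I) * ψ (Y ω) -
            Complex.exp (t * X' ω * Complex.I) * ψ (Y' ω) =
            (Complex.exp (t * X ω * Complex.I) - Complex.exp (t * X' ω * Complex.I)) * ψ (Y ω) +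
            Complex.exp (t * X' ω * Complex.I) * ((ψ (Y ω) - ψ (Y' ω) : ℝ) : ℂ) := by
          push_cast; ring
        rw [e]
        refine (norm_add_le _ _).trans (add_le_add ?_ ?_)
        · rw [norm_mul, Complex.norm_real, Real.norm_eq_abs]
          exact (mul_le_mul (norm_exp_sub_exp_le t (X ω) (X' ω)) (hB (Y ω)) (abs_nonneg _)
            (by positivity)).trans_eq (by ring)
        · rw [norm_mul, norm_exp_mul_mul_I, one_mul, Complex.norm_real]
          exact hK _ _
    _ = |t| * B * ∫ ω, |X ω - X' ω| ∂wiener + K * ∫ ω, |Y ω - Y' ω| ∂wiener := by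
        rw [integral_add (iX.abs.const_mul _) (iY.abs.const_mul _), integral_const_mul,
          integral_const_mul]
    _ ≤ |t| * B * ε + K * ε := by gcongr
    _ = _ := by ring

/-- The difference between the characteristic function of `X` weighted by `ψ(Y)` and the product of
the Gaussian characteristic function with the expectation of `ψ(Y)`. -/
noncomputable def charDefect (v : ℝ≥0) (X Y : (ℕ → ℝ) → ℝ) (ψ : ℝ → ℝ) (t : ℝ) : ℂ :=
  ∫ ω, Complex.exp (t * X ω * Complex.I) * ψ (Y ω) ∂wiener -
    (Real.exp (-(v * t ^ 2 / 2)) : ℂ) * ∫ ω, (ψ (Y ω) : ℂ) ∂wiener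

section Defect

variable {q : ℕ} {X Y : ℕ → L2} {v : ℝ≥0}

lemma tendsto_charDefect_of_deriv (hX : ∀ n, X n ∈ chaos q)
    (hnormal : TendstoInDistribution (fun n => (X n : (ℕ → ℝ) → ℝ)) atTop (id : ℝ → ℝ)
      (fun _ => wiener) (gaussianReal 0 v))
    (hY : Y ∈ indepAlgebra X) {ψ ψ' : ℝ → ℝ} {B B' : ℝ} (hψ : ∀ x, HasDerivAt ψ (ψ' x) x)
    (hψ' : Measurable ψ') (hB : ∀ x, |ψ x| ≤ B) (hB' : ∀ x, |ψ' x| ≤ B') (t : ℝ) :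
    Tendsto (fun n => charDefect v (X n) (Y n) ψ t) atTop (𝓝 0) := by
  have hψm : Measurable ψ :=
    (continuous_iff_continuousAt.2 fun x => (hψ x).continuousAt).measurable
  have hB0' : 0 ≤ B' := (abs_nonneg _).trans (hB' 0)
  have hK : ∀ x y, |ψ x - ψ y| ≤ B' * |x - y| := fun x y =>
    Convex.norm_image_sub_le_of_norm_hasDerivWithin_le (s := Set.univ)
      (fun x _ => (hψ x).hasDerivWithinAt) (fun x _ => hB' x) convex_univ trivial trivial
  obtain ⟨hYD, hYΓ⟩ := hY
  set ε : ℕ → ℝ := fun n => 1 / ((n : ℝ) + 1) with hεdef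
  have hε : ∀ n, 0 < ε n := fun n => by positivity
  have hε0 : Tendsto ε atTop (𝓝 0) := tendsto_one_div_add_atTop_nhds_zero_nat
  have hε0' : Tendsto (fun n => ENNReal.ofReal (ε n)) atTop (𝓝 0) := by
    simpa using ENNReal.tendsto_ofReal hε0
  choose P hP R hPX hRY hΓ using fun n =>
    exists_poly_approx (hX n) (hYD n) (ENNReal.ofReal_pos.2 (hε n))
  have mX := fun n => measurable_L2 (X n)
  have mY := fun n => measurable_L2 (Y n)
  have mP := fun n => measurable_ev (P n)
  have mR := fun n => measurable_ev (R n)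
  have hnormal' : TendstoInDistribution (fun n => ev (P n)) atTop (id : ℝ → ℝ) (fun _ => wiener)
      (gaussianReal 0 v) := by
    refine tendstoInDistribution_of_tendstoInMeasure_sub _ _ hnormal ?_
      fun n => (mP n).aemeasurable
    refine tendstoInMeasure_of_tendsto_eLpNorm (p := 2) (by norm_num)
      (fun n => ((mP n).sub (mX n)).aestronglyMeasurable) aestronglyMeasurable_zero ?_
    refine tendsto_of_tendsto_of_tendsto_of_le_of_le tendsto_const_nhds hε0' (fun _ => zero_le)
      fun n => ?_
    rw [sub_zero]
    exact hPX n
  have hΓ' : Tendsto (fun n => √(Ex (gamma (P n) (R n) ^ 2))) atTop (𝓝 0) := by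
    have h1 : Tendsto (fun n => eLpNorm (ev (gamma (P n) (R n))) 2 wiener) atTop (𝓝 0) :=
      tendsto_of_tendsto_of_tendsto_of_le_of_le tendsto_const_nhds
        (by simpa using hε0'.add hYΓ) (fun _ => zero_le) hΓ
    have h2 := (ENNReal.tendsto_toReal (by simp)).comp h1
    refine h2.congr fun n => ?_
    rw [← norm_toL2_sq, Real.sqrt_sq (norm_nonneg _)]
    exact (Lp.norm_toLp _ (memLp_ev _ (by simp))).symm
  have main := tendsto_charFun_poly hP hnormal' hΓ' hψ hψ' hB hB' t
  have hXP := fun n => integral_abs_sub_le (mP n).aestronglyMeasurable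
    (mX n).aestronglyMeasurable (hε n).le (hPX n)
  have hYR := fun n => integral_abs_sub_le (mR n).aestronglyMeasurable
    (mY n).aestronglyMeasurable (hε n).le (hRY n)
  have d1 := fun n => norm_integral_exp_mul_sub_le (mP n) (mX n) (mR n) (mY n) hψm hB hK hB0'
    (hXP n).1 (hYR n).1 (hXP n).2 (hYR n).2 t
  have d2 := fun n => norm_integral_exp_mul_sub_le (mP n) (mX n) (mR n) (mY n) hψm hB hK hB0'
    (hXP n).1 (hYR n).1 (hXP n).2 (hYR n).2 0
  simp only [Complex.ofReal_zero, zero_mul, Complex.exp_zero, one_mul, abs_zero, zero_add] at d2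
  have z1 : Tendsto (fun n => ∫ ω, Complex.exp (t * ev (P n) ω * Complex.I) * ψ (ev (R n) ω) ∂wiener
      - ∫ ω, Complex.exp (t * X n ω * Complex.I) * ψ (Y n ω) ∂wiener) atTop (𝓝 0) :=
    squeeze_zero_norm d1 (by simpa using hε0.const_mul (|t| * B + B'))
  have z2 : Tendsto (fun n => ∫ ω, (ψ (ev (R n) ω) : ℂ) ∂wiener - ∫ ω, (ψ (Y n ω) : ℂ) ∂wiener)
      atTop (𝓝 0) :=
    squeeze_zero_norm d2 (by simpa using hε0.const_mul B')
  have := (main.sub z1).add (z2.const_mul (Real.exp (-(v * t ^ 2 / 2)) : ℂ))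
  simp only [sub_zero, mul_zero, add_zero] at this
  refine this.congr fun n => ?_
  simp only [charDefect, expW]
  ring

/-- Bounded uniformly continuous functions are uniform limits of bounded `C¹` functions with bounded
derivative, by averaging over short intervals. -/
lemma exists_deriv_approx {ψ : ℝ →ᵇ ℝ} (hψ : UniformContinuous ψ) {ε : ℝ} (hε : 0 < ε) :
    ∃ (χ χ' : ℝ → ℝ) (B B' : ℝ), (∀ x, HasDerivAt χ (χ' x) x) ∧ Measurable χ' ∧
      (∀ x, |χ x| ≤ B) ∧ (∀ x, |χ' x| ≤ B') ∧ ∀ x, |ψ x - χ x| ≤ ε := by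
  obtain ⟨δ, hδ, hδε⟩ := Metric.uniformContinuous_iff.1 hψ ε hε
  have hδ2 : 0 < δ / 2 := by positivity
  have hc := ψ.continuous
  have hint : ∀ a b : ℝ, IntervalIntegrable ψ volume a b := fun a b => hc.intervalIntegrable a b
  set χ : ℝ → ℝ := fun x => (δ / 2)⁻¹ * ((∫ s in (0 : ℝ)..(x + δ / 2), ψ s) - ∫ s in (0 : ℝ)..x, ψ s)
    with hχ
  have hclose : ∀ x, |ψ x - χ x| ≤ ε := by
    intro x
    have e : ψ x - χ x = (δ / 2)⁻¹ * ∫ s in x..(x + δ / 2), (ψ x - ψ s) := by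
      rw [intervalIntegral.integral_sub intervalIntegrable_const (hint _ _),
        intervalIntegral.integral_const, hχ]
      simp only
      rw [intervalIntegral.integral_interval_sub_left (hint _ _) (hint _ _), smul_eq_mul]
      field_simp
      ring
    have hle := intervalIntegral.norm_integral_le_of_norm_le_const (a := x) (b := x + δ / 2)
      (f := fun s => ψ x - ψ s) (C := ε) (fun s hs => by
        rw [Set.uIoc_of_le (by linarith)] at hs
        rw [← dist_eq_norm]
        refine (hδε ?_).le
        rw [Real.dist_eq, abs_lt]
        constructor <;> linarith [hs.1, hs.2])
    rw [e, abs_mul, abs_of_pos (inv_pos.2 hδ2)]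
    rw [add_sub_cancel_left, abs_of_pos hδ2, Real.norm_eq_abs] at hle
    calc (δ / 2)⁻¹ * |∫ s in x..(x + δ / 2), (ψ x - ψ s)| ≤ (δ / 2)⁻¹ * (ε * (δ / 2)) := by
          gcongr
      _ = ε := by field_simp
  refine ⟨χ, fun x => (δ / 2)⁻¹ * (ψ (x + δ / 2) - ψ x), ‖ψ‖ + ε, (δ / 2)⁻¹ * (2 * ‖ψ‖),
    fun x => ?_, Continuous.measurable (by fun_prop), fun x => ?_, fun x => ?_, hclose⟩
  · have h1 : ∀ y, HasDerivAt (fun x => ∫ s in (0 : ℝ)..x, ψ s) (ψ y) y := fun y =>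
      intervalIntegral.integral_hasDerivAt_right (hint _ _)
        hc.aestronglyMeasurable.stronglyMeasurableAtFilter hc.continuousAt
    have h2 := (h1 (x + δ / 2)).comp_add_const x (δ / 2)
    exact (h2.sub (h1 x)).const_mul _
  · have h1 := hclose x
    have h2 := ψ.norm_coe_le_norm x
    rw [Real.norm_eq_abs] at h2
    rw [abs_le] at *
    constructor <;> linarith
  · rw [abs_mul, abs_of_pos (inv_pos.2 hδ2)]
    refine mul_le_mul_of_nonneg_left ?_ (inv_pos.2 hδ2).le
    have h1 := ψ.norm_coe_le_norm x
    have h2 := ψ.norm_coe_le_norm (x + δ / 2)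
    rw [Real.norm_eq_abs] at h1 h2
    rw [abs_le] at *
    constructor <;> linarith

lemma norm_charDefect_sub_le {X Y : (ℕ → ℝ) → ℝ} (hX : Measurable X) (hY : Measurable Y)
    {ψ χ : ℝ → ℝ} (hψ : Measurable ψ) (hχ : Measurable χ) {B B' ε : ℝ} (hB : ∀ x, |ψ x| ≤ B)
    (hB' : ∀ x, |χ x| ≤ B') (h : ∀ x, |ψ x - χ x| ≤ ε) (t : ℝ) :
    ‖charDefect v X Y ψ t - charDefect v X Y χ t‖ ≤ 2 * ε := by
  have key : ∀ s : ℝ, ‖∫ ω, Complex.exp (s * X ω * Complex.I) * ψ (Y ω) ∂wiener -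
      ∫ ω, Complex.exp (s * X ω * Complex.I) * χ (Y ω) ∂wiener‖ ≤ ε := by
    intro s
    rw [← integral_sub (integrable_exp_mul hX hY hψ hB s) (integrable_exp_mul hX hY hχ hB' s)]
    have := norm_integral_le_of_norm_le_const (μ := wiener)
      (f := fun ω => Complex.exp (s * X ω * Complex.I) * ψ (Y ω) -
        Complex.exp (s * X ω * Complex.I) * χ (Y ω)) (C := ε) (ae_of_all _ fun ω => by
        rw [← mul_sub, norm_mul, norm_exp_mul_mul_I, one_mul, ← Complex.ofReal_sub,
          Complex.norm_real]
        exact h _)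
    simpa using this
  have k0 := key 0
  simp only [Complex.ofReal_zero, zero_mul, Complex.exp_zero, one_mul] at k0
  have e : charDefect v X Y ψ t - charDefect v X Y χ t =
      (∫ ω, Complex.exp (t * X ω * Complex.I) * ψ (Y ω) ∂wiener -
        ∫ ω, Complex.exp (t * X ω * Complex.I) * χ (Y ω) ∂wiener) -
      (Real.exp (-(v * t ^ 2 / 2)) : ℂ) *
        (∫ ω, (ψ (Y ω) : ℂ) ∂wiener - ∫ ω, (χ (Y ω) : ℂ) ∂wiener) := by
    simp only [charDefect]; ring
  have hexp : ‖(Real.exp (-(v * t ^ 2 / 2)) : ℂ)‖ ≤ 1 := by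
    rw [Complex.norm_real, Real.norm_eq_abs, abs_of_pos (Real.exp_pos _), Real.exp_le_one_iff]
    have := v.coe_nonneg
    have : 0 ≤ (v : ℝ) * t ^ 2 / 2 := by positivity
    linarith
  rw [e]
  refine (norm_sub_le _ _).trans ?_
  rw [norm_mul, two_mul]
  refine add_le_add (key t) ?_
  calc _ ≤ 1 * ε := mul_le_mul hexp k0 (norm_nonneg _) zero_le_one
    _ = ε := one_mul ε

lemma tendsto_charDefect (hX : ∀ n, X n ∈ chaos q)
    (hnormal : TendstoInDistribution (fun n => (X n : (ℕ → ℝ) → ℝ)) atTop (id : ℝ → ℝ)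
      (fun _ => wiener) (gaussianReal 0 v))
    (hY : Y ∈ indepAlgebra X) {ψ : ℝ →ᵇ ℝ} (hψ : UniformContinuous ψ) (t : ℝ) :
    Tendsto (fun n => charDefect v (X n) (Y n) ψ t) atTop (𝓝 0) := by
  rw [Metric.tendsto_atTop]
  intro ε hε
  obtain ⟨χ, χ', B, B', hd, hm, hB, hB', hclose⟩ := exists_deriv_approx hψ
    (show (0 : ℝ) < ε / 4 by positivity)
  obtain ⟨N, hN⟩ := Metric.tendsto_atTop.1
    (tendsto_charDefect_of_deriv hX hnormal hY hd hm hB hB' t) (ε / 2) (by positivity)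
  refine ⟨N, fun n hn => ?_⟩
  have h1 := hN n hn
  have h2 := norm_charDefect_sub_le (v := v) (measurable_L2 (X n)) (measurable_L2 (Y n))
    ψ.continuous.measurable
    (continuous_iff_continuousAt.2 fun x => (hd x).continuousAt).measurable
    (fun x => ψ.norm_coe_le_norm x) hB hclose t
  rw [dist_zero_right] at h1 ⊢
  have h3 := norm_add_le (charDefect v (X n) (Y n) ψ t - charDefect v (X n) (Y n) χ t)
    (charDefect v (X n) (Y n) χ t)
  rw [sub_add_cancel] at h3
  linarith

end Defect

/-! ### Asymptotic independence -/

/-- The law of `X` under the probability measure with density `w / ∫ w`, in terms of integrals of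
bounded functions. -/
lemma exists_weighted_law {X w : (ℕ → ℝ) → ℝ} (hX : Measurable X) (hw : Measurable w) {B : ℝ}
    (hw1 : ∀ ω, 1 ≤ w ω) (hwB : ∀ ω, w ω ≤ B) :
    ∃ ν : ProbabilityMeasure ℝ,
      (∀ φ : ℝ →ᵇ ℝ, ∫ x, φ x ∂(ν : Measure ℝ) =
        (∫ ω, w ω ∂wiener)⁻¹ * ∫ ω, φ (X ω) * w ω ∂wiener) ∧
      ∀ t : ℝ, charFun (ν : Measure ℝ) t =
        ((∫ ω, w ω ∂wiener : ℝ) : ℂ)⁻¹ *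
          ∫ ω, Complex.exp (t * X ω * Complex.I) * w ω ∂wiener := by
  have hi : Integrable w wiener := Integrable.of_bound hw.aestronglyMeasurable (C := B)
    (ae_of_all _ fun ω => by
      rw [Real.norm_eq_abs, abs_of_nonneg (zero_le_one.trans (hw1 ω))]; exact hwB ω)
  set m := ∫ ω, w ω ∂wiener with hm
  have hm1 : 1 ≤ m := by
    have := integral_mono (integrable_const (1 : ℝ)) hi hw1
    simpa using this
  have hm0 : 0 < m := by linarith
  set ρ : (ℕ → ℝ) → ℝ≥0 := fun ω => (w ω / m).toNNReal with hρ
  have hρm : Measurable ρ := (hw.div_const m).real_toNNReal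
  have hρv : ∀ ω, (ρ ω : ℝ) = m⁻¹ * w ω := fun ω => by
    rw [hρ]
    simp only
    rw [Real.coe_toNNReal _ (div_nonneg (zero_le_one.trans (hw1 ω)) hm0.le), div_eq_inv_mul]
  set μ := wiener.withDensity fun ω => (ρ ω : ℝ≥0∞) with hμ
  have hμp : IsProbabilityMeasure μ := by
    refine ⟨?_⟩
    rw [hμ, withDensity_apply _ MeasurableSet.univ, Measure.restrict_univ]
    have h1 : ∀ ω, (ρ ω : ℝ≥0∞) = ENNReal.ofReal (m⁻¹ * w ω) := fun ω => by
      rw [← hρv, ENNReal.ofReal_coe_nnreal]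
    simp_rw [h1]
    rw [← ofReal_integral_eq_lintegral_ofReal (hi.const_mul _) (ae_of_all _ fun ω =>
      mul_nonneg (inv_nonneg.2 hm0.le) (zero_le_one.trans (hw1 ω))), integral_const_mul, ← hm,
      inv_mul_cancel₀ hm0.ne', ENNReal.ofReal_one]
  refine ⟨⟨μ.map X, Measure.isProbabilityMeasure_map hX.aemeasurable⟩, fun φ => ?_, fun t => ?_⟩
  · rw [ProbabilityMeasure.coe_mk, integral_map hX.aemeasurable
      φ.continuous.aestronglyMeasurable, hμ, integral_withDensity_eq_integral_smul hρm,
      ← integral_const_mul]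
    refine integral_congr_ae (ae_of_all _ fun ω => ?_)
    simp only [NNReal.smul_def, smul_eq_mul, hρv]
    ring
  · rw [ProbabilityMeasure.coe_mk, charFun_apply_real, integral_map hX.aemeasurable
      (by fun_prop), hμ, integral_withDensity_eq_integral_smul hρm, ← integral_const_mul]
    refine integral_congr_ae (ae_of_all _ fun ω => ?_)
    simp only [NNReal.smul_def, Complex.real_smul, hρv]
    push_cast
    ring

variable {q : ℕ} {X Y : ℕ → L2} {v : ℝ≥0}

lemma integrable_bcf_comp (ψ : ℝ →ᵇ ℝ) {Z : (ℕ → ℝ) → ℝ} (hZ : Measurable Z) :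
    Integrable (fun ω => ψ (Z ω)) wiener :=
  Integrable.of_bound (ψ.continuous.measurable.comp hZ).aestronglyMeasurable ‖ψ‖
    (ae_of_all _ fun ω => ψ.norm_coe_le_norm (Z ω))

lemma integrable_bcf_comp_mul (φ ψ : ℝ →ᵇ ℝ) {Z W : (ℕ → ℝ) → ℝ} (hZ : Measurable Z)
    (hW : Measurable W) : Integrable (fun ω => φ (Z ω) * ψ (W ω)) wiener :=
  (integrable_bcf_comp ψ hW).bdd_mul
    (φ.continuous.measurable.comp hZ).aestronglyMeasurable
    (ae_of_all _ fun ω => φ.norm_coe_le_norm (Z ω))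

/-- Asymptotic independence, from the convergence of the characteristic functions weighted by
`ψ(Y n)`: after adding a constant to `ψ`, Lévy's continuity theorem applies to the laws of `X n`
under the measures with density proportional to the weight. -/
lemma tendsto_cov_of_uniformContinuous (hX : ∀ n, X n ∈ chaos q)
    (hnormal : TendstoInDistribution (fun n => (X n : (ℕ → ℝ) → ℝ)) atTop (id : ℝ → ℝ)
      (fun _ => wiener) (gaussianReal 0 v))
    (hY : Y ∈ indepAlgebra X) (φ : ℝ →ᵇ ℝ) {ψ : ℝ →ᵇ ℝ} (hψ : UniformContinuous ψ) :
    Tendsto (fun n => (∫ ω, φ (X n ω) * ψ (Y n ω) ∂wiener) -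
      (∫ ω, φ (X n ω) ∂wiener) * (∫ ω, ψ (Y n ω) ∂wiener)) atTop (𝓝 0) := by
  have mX := fun n => measurable_L2 (X n)
  have mY := fun n => measurable_L2 (Y n)
  set c : ℝ := ‖ψ‖ + 1 with hc
  set w : ℕ → (ℕ → ℝ) → ℝ := fun n ω => ψ (Y n ω) + c with hw
  have hψb : ∀ x, -‖ψ‖ ≤ ψ x ∧ ψ x ≤ ‖ψ‖ := fun x => abs_le.1 (ψ.norm_coe_le_norm x)
  have hw1 : ∀ n ω, 1 ≤ w n ω := fun n ω => by
    have := (hψb (Y n ω)).1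
    simp only [hw, hc]; linarith
  have hwB : ∀ n ω, w n ω ≤ 2 * ‖ψ‖ + 1 := fun n ω => by
    have := (hψb (Y n ω)).2
    simp only [hw, hc]; linarith
  have hwm : ∀ n, Measurable (w n) := fun n => (ψ.continuous.measurable.comp (mY n)).add_const c
  have iψ := fun n => integrable_bcf_comp ψ (mY n)
  have iφ := fun n => integrable_bcf_comp φ (mX n)
  have iφψ := fun n => integrable_bcf_comp_mul φ ψ (mX n) (mY n)
  set m : ℕ → ℝ := fun n => ∫ ω, w n ω ∂wiener with hm
  have hmψ : ∀ n, m n = ∫ ω, ψ (Y n ω) ∂wiener + c := fun n => by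
    simp only [hm, hw]
    rw [integral_add (iψ n) (integrable_const c)]; simp
  have iw : ∀ n, Integrable (w n) wiener := fun n => (iψ n).add (integrable_const c)
  have hm1 : ∀ n, 1 ≤ m n := fun n => by
    have := integral_mono (integrable_const (1 : ℝ)) (iw n) (hw1 n)
    simpa using this
  have hmB : ∀ n, m n ≤ 2 * ‖ψ‖ + 1 := fun n => by
    have := integral_mono (iw n) (integrable_const (2 * ‖ψ‖ + 1)) (hwB n)
    simpa using this
  choose ν hνφ hνc using fun n => exists_weighted_law (mX n) (hwm n) (hw1 n) (hwB n)
  -- convergence of the characteristic functions of the weighted laws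
  have hchar : ∀ t : ℝ, Tendsto (fun n => charFun (ν n : Measure ℝ) t) atTop
      (𝓝 (charFun (gaussianReal 0 v) t)) := by
    intro t
    have h1 := tendsto_charDefect hX hnormal hY hψ t
    have h2 := (tendsto_charFun_map hnormal t).sub_const (charFun (gaussianReal 0 v) t)
    rw [sub_self] at h2
    have h3 := h1.add (h2.const_mul (c : ℂ))
    rw [mul_zero, add_zero, tendsto_zero_iff_norm_tendsto_zero] at h3
    rw [tendsto_iff_norm_sub_tendsto_zero]
    refine squeeze_zero (fun _ => norm_nonneg _) (fun n => ?_) h3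
    have hmn : (m n : ℂ) ≠ 0 := by
      exact_mod_cast (zero_lt_one.trans_le (hm1 n)).ne'
    have i1 := integrable_exp_mul (mX n) (mY n) ψ.continuous.measurable
      (fun x => ψ.norm_coe_le_norm x) t
    have i2 := integrable_exp_mul (mX n) (mY n) (ψ := fun _ => (1 : ℝ)) measurable_const (B := 1)
      (fun x => by simp) t
    simp only [Complex.ofReal_one, mul_one] at i2
    have e1 : ∫ ω, Complex.exp (t * X n ω * Complex.I) * w n ω ∂wiener =
        ∫ ω, Complex.exp (t * X n ω * Complex.I) * ψ (Y n ω) ∂wiener +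
          c * charFun (wiener.map (X n)) t := by
      rw [charFun_map_eq (mX n).aemeasurable, ← integral_const_mul,
        ← integral_add i1 (i2.const_mul _)]
      refine integral_congr_ae (ae_of_all _ fun ω => ?_)
      simp only [hw]
      push_cast
      ring
    have e2 : (m n : ℂ) = ∫ ω, (ψ (Y n ω) : ℂ) ∂wiener + c := by
      rw [hmψ n, integral_complex_ofReal]
      push_cast
      ring
    have e3 : charFun (ν n : Measure ℝ) t - charFun (gaussianReal 0 v) t =
        (m n : ℂ)⁻¹ * (charDefect v (X n) (Y n) ψ t +
          c * (charFun (wiener.map (X n)) t - charFun (gaussianReal 0 v) t)) := by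
      rw [hνc n t, e1, charDefect, ← charFun_gaussianReal_zero]
      change (m n : ℂ)⁻¹ * _ - _ = _
      rw [eq_inv_mul_iff_mul_eq₀ hmn, mul_sub, mul_inv_cancel_left₀ hmn, e2]
      ring
    rw [e3, norm_mul]
    refine mul_le_of_le_one_left (norm_nonneg _) ?_
    rw [norm_inv, Complex.norm_real, Real.norm_eq_abs,
      abs_of_pos (zero_lt_one.trans_le (hm1 n))]
    exact inv_le_one_of_one_le₀ (hm1 n)
  have hlim : Tendsto ν atTop (𝓝 (⟨gaussianReal 0 v, inferInstance⟩ : ProbabilityMeasure ℝ)) :=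
    ProbabilityMeasure.tendsto_of_tendsto_charFun hchar
  have l1 := ProbabilityMeasure.tendsto_iff_forall_integral_tendsto.1 hlim φ
  have l2 := tendsto_integral_bcf hnormal φ
  have l3 := l1.sub l2
  rw [ProbabilityMeasure.coe_mk, sub_self, tendsto_zero_iff_norm_tendsto_zero] at l3
  have l4 := l3.const_mul (2 * ‖ψ‖ + 1)
  rw [mul_zero] at l4
  refine squeeze_zero_norm (fun n => ?_) l4
  have hmn : m n ≠ 0 := (zero_lt_one.trans_le (hm1 n)).ne'
  have e : (∫ ω, φ (X n ω) * ψ (Y n ω) ∂wiener) -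
      (∫ ω, φ (X n ω) ∂wiener) * (∫ ω, ψ (Y n ω) ∂wiener) =
      m n * (∫ x, φ x ∂(ν n : Measure ℝ) - ∫ ω, φ (X n ω) ∂wiener) := by
    have e1 : ∫ ω, φ (X n ω) * w n ω ∂wiener =
        ∫ ω, φ (X n ω) * ψ (Y n ω) ∂wiener + c * ∫ ω, φ (X n ω) ∂wiener := by
      rw [← integral_const_mul, ← integral_add (iφψ n) ((iφ n).const_mul c)]
      refine integral_congr_ae (ae_of_all _ fun ω => ?_)
      simp only [hw]
      ring
    rw [hνφ n φ]
    change _ = m n * ((m n)⁻¹ * _ - _)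
    rw [mul_sub, mul_inv_cancel_left₀ hmn, e1, hmψ n]
    ring
  rw [e, norm_mul, Real.norm_eq_abs (m n), abs_of_pos (zero_lt_one.trans_le (hm1 n))]
  exact mul_le_mul_of_nonneg_right (hmB n) (norm_nonneg _)

/-- Composition of a continuous function with the projection onto `[-r, r]`: this is uniformly
continuous and unchanged on `[-r, r]`. -/
lemma exists_uniformContinuous_eqOn (ψ : ℝ →ᵇ ℝ) {r : ℝ} (hr : 0 ≤ r) :
    ∃ χ : ℝ →ᵇ ℝ, UniformContinuous χ ∧ (∀ x, |x| ≤ r → χ x = ψ x) ∧ ∀ x, |χ x| ≤ ‖ψ‖ := by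
  have h : -r ≤ r := by linarith
  let g : C(ℝ, ℝ) := ⟨fun x => (Set.projIcc (-r) r h x : ℝ),
    continuous_subtype_val.comp continuous_projIcc⟩
  refine ⟨ψ.compContinuous g, ?_, fun x hx => ?_, fun x => ψ.norm_coe_le_norm _⟩
  · have h1 : UniformContinuous fun y : Set.Icc (-r) r => ψ y :=
      CompactSpace.uniformContinuous_of_continuous (by fun_prop)
    exact h1.comp (LipschitzWith.projIcc h).uniformContinuous
  · have hx' : x ∈ Set.Icc (-r) r := abs_le.1 hx
    change ψ (Set.projIcc (-r) r h x : ℝ) = ψ x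
    rw [Set.projIcc_of_mem h hx']

lemma abs_integral_mul_sub_le {f g h : (ℕ → ℝ) → ℝ} {A : Set (ℕ → ℝ)} (hA : MeasurableSet A)
    {a b : ℝ} (ifg : Integrable (fun ω => f ω * g ω) wiener)
    (ifh : Integrable (fun ω => f ω * h ω) wiener)
    (hf : ∀ ω, |f ω| ≤ a) (hgh : ∀ ω, |g ω - h ω| ≤ b) (heq : ∀ ω ∉ A, g ω = h ω) :
    |∫ ω, f ω * g ω ∂wiener - ∫ ω, f ω * h ω ∂wiener| ≤ a * b * wiener.real A := by
  rw [← integral_sub ifg ifh, ← Real.norm_eq_abs]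
  have ha : 0 ≤ a := (abs_nonneg _).trans (hf 0)
  calc _ ≤ ∫ ω, A.indicator (fun _ => a * b) ω ∂wiener := by
        refine norm_integral_le_of_norm_le ((integrable_const (μ := wiener) (a * b)).indicator hA)
          (ae_of_all _ fun ω => ?_)
        rw [← mul_sub, norm_mul, Real.norm_eq_abs, Real.norm_eq_abs]
        by_cases hω : ω ∈ A
        · rw [Set.indicator_of_mem hω]
          exact mul_le_mul (hf ω) (hgh ω) (abs_nonneg _) ha
        · rw [Set.indicator_of_notMem hω, heq ω hω]
          simp
    _ = a * b * wiener.real A := by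
        rw [integral_indicator_const _ hA, smul_eq_mul, mul_comm]

lemma tendsto_cov_of_tight (hX : ∀ n, X n ∈ chaos q)
    (hnormal : TendstoInDistribution (fun n => (X n : (ℕ → ℝ) → ℝ)) atTop (id : ℝ → ℝ)
      (fun _ => wiener) (gaussianReal 0 v))
    (hY : Y ∈ indepAlgebra X)
    (hT : IsTightMeasureSet (Set.range fun n => wiener.map (Y n))) (φ ψ : ℝ →ᵇ ℝ) :
    Tendsto (fun n => (∫ ω, φ (X n ω) * ψ (Y n ω) ∂wiener) -
      (∫ ω, φ (X n ω) ∂wiener) * (∫ ω, ψ (Y n ω) ∂wiener)) atTop (𝓝 0) := by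
  have mX := fun n => measurable_L2 (X n)
  have mY := fun n => measurable_L2 (Y n)
  rw [Metric.tendsto_atTop]
  intro ε hε
  set K := ‖φ‖ * (2 * ‖ψ‖) with hK
  have hK0 : 0 ≤ K := by positivity
  set δ := ε / (4 * (K + 1)) with hδdef
  have hδ : 0 < δ := by positivity
  have hKδ : K * δ ≤ ε / 4 := by
    have : (K + 1) * δ = ε / 4 := by rw [hδdef]; field_simp
    nlinarith
  have ht := isTightMeasureSet_iff_tendsto_measure_norm_gt.1 hT
  obtain ⟨r, hr, hr0⟩ := ((ht.eventually (Iic_mem_nhds (ENNReal.ofReal_pos.2 hδ))).and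
    (eventually_ge_atTop 0)).exists
  have hA : ∀ n, wiener.real {ω | r < ‖Y n ω‖} ≤ δ := fun n => by
    have h1 : wiener.map (Y n) {x | r < ‖x‖} ≤ ENNReal.ofReal δ :=
      (le_iSup₂ (f := fun μ (_ : μ ∈ Set.range fun n => wiener.map (Y n)) => μ {x | r < ‖x‖})
        (wiener.map (Y n)) ⟨n, rfl⟩).trans hr
    rw [Measure.map_apply (mY n) (measurableSet_lt measurable_const measurable_norm)] at h1
    exact ENNReal.toReal_le_of_le_ofReal hδ.le h1
  obtain ⟨χ, hχu, hχeq, hχb⟩ := exists_uniformContinuous_eqOn ψ hr0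
  obtain ⟨N, hN⟩ := Metric.tendsto_atTop.1 (tendsto_cov_of_uniformContinuous hX hnormal hY φ hχu)
    (ε / 2) (by positivity)
  refine ⟨N, fun n hn => ?_⟩
  have h0 := hN n hn
  have hAm : MeasurableSet {ω | r < ‖Y n ω‖} := measurableSet_lt measurable_const (mY n).norm
  have hdiff : ∀ ω, |ψ (Y n ω) - χ (Y n ω)| ≤ 2 * ‖ψ‖ := fun ω => by
    have h1 := abs_le.1 (ψ.norm_coe_le_norm (Y n ω))
    have h2 := abs_le.1 (hχb (Y n ω))
    rw [abs_le]
    constructor <;> linarith [h1.1, h1.2, h2.1, h2.2]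
  have heq : ∀ ω ∉ {ω | r < ‖Y n ω‖}, ψ (Y n ω) = χ (Y n ω) := fun ω hω =>
    (hχeq _ (by simpa using hω)).symm
  have d1 := abs_integral_mul_sub_le hAm (integrable_bcf_comp_mul φ ψ (mX n) (mY n))
    (integrable_bcf_comp_mul φ χ (mX n) (mY n)) (fun ω => φ.norm_coe_le_norm (X n ω)) hdiff heq
  have d2 := abs_integral_mul_sub_le (f := fun _ => ∫ ω, φ (X n ω) ∂wiener) (a := ‖φ‖) hAm
    ((integrable_bcf_comp ψ (mY n)).const_mul _) ((integrable_bcf_comp χ (mY n)).const_mul _)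
    (fun _ => by
      have := norm_integral_le_of_norm_le_const (μ := wiener) (f := fun ω => φ (X n ω))
        (ae_of_all _ fun ω => φ.norm_coe_le_norm (X n ω))
      simpa using this) hdiff heq
  rw [integral_const_mul, integral_const_mul] at d2
  have hKA : K * wiener.real {ω | r < ‖Y n ω‖} ≤ ε / 4 :=
    (mul_le_mul_of_nonneg_left (hA n) hK0).trans hKδ
  have d1' := d1.trans hKA
  have d2' := d2.trans hKA
  rw [Real.dist_eq, sub_zero, abs_lt] at h0 ⊢
  rw [abs_le] at d1' d2'
  constructor <;> linarith [h0.1, h0.2, d1'.1, d1'.2, d2'.1, d2'.2]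

end WienerSpace

theorem mainTheorem5 (q : ℕ) (X Y : ℕ → WienerSpace.L2)
    (hX : ∀ n, X n ∈ WienerSpace.chaos q)
    (v : ℝ≥0)
    (hnormal : TendstoInDistribution (fun n => (X n : (ℕ → ℝ) → ℝ)) atTop (id : ℝ → ℝ)
      (fun _ => WienerSpace.wiener) (gaussianReal 0 v))
    (hY : Y ∈ WienerSpace.indepAlgebra X) :
    (∀ φ ψ : ℝ →ᵇ ℝ, UniformContinuous ψ →
      Tendsto (fun n => (∫ ω, φ (X n ω) * ψ (Y n ω) ∂WienerSpace.wiener) -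
          (∫ ω, φ (X n ω) ∂WienerSpace.wiener) * (∫ ω, ψ (Y n ω) ∂WienerSpace.wiener))
        atTop (𝓝 0)) ∧
    (IsTightMeasureSet (Set.range fun n => WienerSpace.wiener.map (Y n)) →
      ∀ φ ψ : ℝ →ᵇ ℝ,
        Tendsto (fun n => (∫ ω, φ (X n ω) * ψ (Y n ω) ∂WienerSpace.wiener) -
            (∫ ω, φ (X n ω) ∂WienerSpace.wiener) * (∫ ω, ψ (Y n ω) ∂WienerSpace.wiener))
          atTop (𝓝 0)) := by
  exact ⟨fun φ ψ hψ => WienerSpace.tendsto_cov_of_uniformContinuous hX hnormal hY φ hψ,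
    fun hT φ ψ => WienerSpace.tendsto_cov_of_tight hX hnormal hY hT φ ψ⟩
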